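/- Setting. Let $m,\ell\ge 1$ be integers, $\omega=(m,-\ell)$, $\kappa=m+\ell$, and let $\mathcal C_\omega=\mathbb Z^2/\mathbb Z\omega$ with projection $\pi$. Order $\mathcal C_\omega$ by: $x\le y$ iff there are lifts $(a,b)$ of $x$ and $(a',b')$ of $y$ with $a\ge a'$ and $b\ge b'$. The content of $\pi(a,b)$ is $c(\pi(a,b))=b-a \bmod \kappa\in\mathbb Z/\kappa\mathbb Z$. A cylindric diagram is an order filter $\theta\subset\mathcal C_\omega$ with $\theta\neq\emptyset,\mathcal C_\omega$; $\mathcal I(\theta)$ is the set of order ideals $\xi\ne\theta$ of $\theta$ (the cylindric skew diagrams which are order ideals of $\theta$), ordered by inclusion. For a finite poset $P$, let $\mathcal I(P)$ be the set of all order ideals of $P$ ($P$ itself included), ordered by inclusion; thus $\mathcal I(\xi)=\{\eta\in\mathcal I(\theta)\mid\eta\subseteq\xi\}$ for $\xi\in\mathcal I(\theta)$. Over a field of characteristic $0$, let $\mathfrak h$ have basis $\alpha_i^\vee$ $(i\in\mathbb Z/\kappa\mathbb Z)$, $d$, and define $\alpha_j\in\mathfrak h^*$ by $\langle\alpha_j,\alpha_i^\vee\rangle=a_{ij}$,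 $\langle\alpha_j,d\rangle=\delta_{j0}$, where $(a_{ij})$ is the Cartan matrix of type $A^{(1)}_{\kappa-1}$. Let $W\subset GL(\mathfrak h^*)$ be the affine Weyl group, generated by $s_i(\zeta)=\zeta-\langle\zeta,\alpha_i^\vee\rangle\alpha_i$, with length function $\ell(\cdot)$. Let $R=W\{\alpha_i\}$, $Q_+=\sum_i\mathbb Z_{\ge0}\alpha_i$, $R_+=R\cap Q_+$, $R_-=R\cap(-Q_+)$, and $R(w)=R_+\cap wR_-$ for $w\in W$. The weak right Bruhat order $\preceq$ on $W$ is the reflexive-transitive closure of the relations $v\prec w$ whenever $w=vs_i$ for some $i$ and $\ell(w)=\ell(v)+1$; $[e,w]=\{x\in W\mid e\preceq x\preceq w\}$. Let $\theta$ be a cylindric diagram. For $x\in\theta$ put $\alpha(x)=\alpha_{c(x)}$, $s(x)=s_{c(x)}$, $\mathrm{arm}(x)=\{x+(0,k)\in\theta\mid k\ge1\}$, $\mathrm{leg}(x)=\{x+(k,0)\in\theta\mid k\ge1\}$, and $$\mathbf h(x)=\alpha(x)+\sum_{y\in\mathrm{arm}(x)}\alpha(y)+\sum_{y\in\mathrm{leg}(x)}\alpha(y).$$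 Let $\Gamma\subset\theta$ be the set of the minimum elements of the fibres of $c:\theta\to\mathbb Z/\kappa\mathbb Z$, and $\Gamma_{\max},\Gamma_{\min}$ its sets of maximal and minimal elements. Let $\Pi_\theta$ consist of the $\alpha(x)$ for $x\in\Gamma\setminus(\Gamma_{\max}\cup\Gamma_{\min})$ and of $\alpha(x)+\sum_{y\in\mathrm{arm}(x)}\alpha(y)$ and $\alpha(x)+\sum_{y\in\mathrm{leg}(x)}\alpha(y)$ for $x\in\Gamma_{\max}$. Write $\alpha\le^{\mathrm{cyl}}\beta$ iff $\beta-\alpha\in\sum_{\gamma\in\Pi_\theta}\mathbb Z_{\ge0}\gamma$. For a finite set $\xi$ of $n$ cells, a standard tableau on $\xi$ is a bijection $T:\xi\to[1,n]=\{1,\dots,n\}$ such that $x<y$ implies $T(x)<T(y)$. Put $w_{\xi,T}=s(T^{-1}(1))s(T^{-1}(2))\cdots s(T^{-1}(n))\in W$. With $i_k=c(T^{-1}(k))$, the heap order $\le^{\mathrm{hp}}_T$ on $[1,n]$ is the transitive closure of the relations $a\le^{\mathrm{hp}}_T b$ whenever $a\le b$ and either $s_{i_a}s_{i_b}\ne s_{i_b}s_{i_a}$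 or $i_a=i_b$. Theorem. Let $\theta$ be a cylindric diagram in $\mathcal C_\omega$ and let $\xi\in\mathcal I(\theta)$. Then $\xi$ is finite, it has a standard tableau, and $w_\xi:=w_{\xi,T}$ does not depend on the standard tableau $T$ on $\xi$ (this applies to every $\eta\in\mathcal I(\xi)$ as well). With $n=|\xi|$, moreover: 1. $x\mapsto\mathbf h(x)$ is a poset isomorphism $(\xi,\le)\to(R(w_\xi),\le^{\mathrm{cyl}})$. 2. Every standard tableau $T$ on $\xi$ is a poset isomorphism $(\xi,\le)\to([1,n],\le^{\mathrm{hp}}_T)$. 3. $\eta\mapsto w_\eta$ is a poset isomorphism $(\mathcal I(\xi),\subseteq)\to([e,w_\xi],\preceq)$. 4. $w\mapsto R(w)$ is a poset isomorphism $([e,w_\xi],\preceq)\to(\mathcal I(R(w_\xi)),\subseteq)$, where $R(w_\xi)$ is ordered by $\le^{\mathrm{cyl}}$. -/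

import Mathlib

noncomputable section

namespace CylindricDiagram

/-! ## The affine root system of type `A_{κ-1}^{(1)}` -/

section RootSystem

variable (𝕂 : Type*) [Field 𝕂] (κ : ℕ)

/-- The `(κ+1)`-dimensional space `𝔥` with basis `α_i^∨` (`i ∈ ℤ/κℤ`) and `d`. -/
abbrev Cartan : Type _ := (ZMod κ →₀ 𝕂) × 𝕂

/-- The dual space `𝔥^*`. -/
abbrev CartanDual : Type _ := Module.Dual 𝕂 (Cartan 𝕂 κ)

variable {κ}

/-- The simple coroot `α_i^∨`. -/
def simpleCoroot (i : ZMod κ) : Cartan 𝕂 κ := (Finsupp.single i 1, 0)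

/-- The basis vector `d`. -/
def scalingElement : Cartan 𝕂 κ := (0, 1)

/-- The entries `a_{ij}` of the Cartan matrix of type `A_{κ-1}^{(1)}`, for `κ ≥ 2`. -/
def cartanEntry (i j : ZMod κ) : ℤ :=
  if i = j then 2
  else if κ = 2 then -2
  else if i - j = 1 ∨ i - j = -1 then -1
  else 0

/-- The simple root `α_j`: the linear form with `⟨α_j, α_i^∨⟩ = a_{ij}` and
`⟨α_j, d⟩ = δ_{j0}`. -/
def simpleRoot (j : ZMod κ) : CartanDual 𝕂 κ :=
  LinearMap.coprod (Finsupp.linearCombination 𝕂 fun i : ZMod κ => (cartanEntry i j : 𝕂))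
    (if j = 0 then LinearMap.id else 0)

theorem simpleRoot_simpleCoroot (i j : ZMod κ) :
    simpleRoot 𝕂 j (simpleCoroot 𝕂 i) = (cartanEntry i j : 𝕂) := by
  simp [simpleRoot, simpleCoroot]

theorem simpleRoot_scalingElement (j : ZMod κ) :
    simpleRoot 𝕂 j (scalingElement 𝕂) = if j = 0 then 1 else 0 := by
  by_cases h : j = 0 <;> simp [simpleRoot, scalingElement, h]

theorem eval_simpleCoroot_simpleRoot (i : ZMod κ) :
    Module.Dual.eval 𝕂 (Cartan 𝕂 κ) (simpleCoroot 𝕂 i) (simpleRoot 𝕂 i) = 2 := by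
  simp [simpleRoot_simpleCoroot, cartanEntry]

/-- The simple reflection `ζ ↦ ζ - ⟨ζ, α_i^∨⟩ α_i` in `GL(𝔥^*)`. -/
def simpleReflectionGL (i : ZMod κ) : CartanDual 𝕂 κ ≃ₗ[𝕂] CartanDual 𝕂 κ :=
  Module.reflection (eval_simpleCoroot_simpleRoot 𝕂 i)

theorem simpleReflectionGL_apply (i : ZMod κ) (ζ : CartanDual 𝕂 κ) :
    simpleReflectionGL 𝕂 i ζ = ζ - ζ (simpleCoroot 𝕂 i) • simpleRoot 𝕂 i := by
  simp [simpleReflectionGL, Module.reflection_apply]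

variable (κ)

/-- The affine Weyl group `W`, generated by the simple reflections in `GL(𝔥^*)`. -/
def weylGroup : Subgroup (CartanDual 𝕂 κ ≃ₗ[𝕂] CartanDual 𝕂 κ) :=
  Subgroup.closure (Set.range (simpleReflectionGL 𝕂 (κ := κ)))

variable {κ}

/-- The simple reflection `s_i` as an element of `W`. -/
def s (i : ZMod κ) : weylGroup 𝕂 κ :=
  ⟨simpleReflectionGL 𝕂 i, Subgroup.subset_closure ⟨i, rfl⟩⟩

variable (κ)

/-- `Q_+`, the nonnegative integer combinations of the simple roots. -/
def rootCone : AddSubmonoid (CartanDual 𝕂 κ) :=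
  AddSubmonoid.closure (Set.range (simpleRoot 𝕂 (κ := κ)))

/-- The set `R = W Π` of real roots. -/
def realRoots : Set (CartanDual 𝕂 κ) :=
  {β | ∃ (w : weylGroup 𝕂 κ) (i : ZMod κ), β = w.1 (simpleRoot 𝕂 i)}

/-- The positive real roots `R_+`. -/
def posRoots : Set (CartanDual 𝕂 κ) := {β | β ∈ realRoots 𝕂 κ ∧ β ∈ rootCone 𝕂 κ}

/-- The negative real roots `R_-`. -/
def negRoots : Set (CartanDual 𝕂 κ) := {β | β ∈ realRoots 𝕂 κ ∧ -β ∈ rootCone 𝕂 κ}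

variable {𝕂 κ}

/-- The inversion set `R(w) = R_+ ∩ w R_-`. -/
def inversionSet (w : weylGroup 𝕂 κ) : Set (CartanDual 𝕂 κ) :=
  posRoots 𝕂 κ ∩ (fun β => w.1 β) '' negRoots 𝕂 κ

/-- The length of `w`: the least number of factors in an expression of `w` as a product of
simple reflections. -/
def length (w : weylGroup 𝕂 κ) : ℕ :=
  sInf {r | ∃ L : List (ZMod κ), L.length = r ∧ (L.map (s 𝕂)).prod = w}

/-- `v ⋖ w`: one has `ℓ(w) = ℓ(v) + 1` and `w = v s_i` for a simple reflection `s_i`. -/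
def weakCover (v w : weylGroup 𝕂 κ) : Prop :=
  length w = length v + 1 ∧ ∃ i : ZMod κ, w = v * s 𝕂 i

/-- The weak right Bruhat order on `W`. -/
def weakLE : weylGroup 𝕂 κ → weylGroup 𝕂 κ → Prop := Relation.ReflTransGen weakCover

/-- The interval `[e, w]` of the weak right Bruhat order. -/
def weakInterval (w : weylGroup 𝕂 κ) : Set (weylGroup 𝕂 κ) := {x | weakLE 1 x ∧ weakLE x w}

end RootSystem

/-! ## Posets -/

section Posets

variable {A B : Type*}

/-- `f` restricts to an isomorphism from `S`, ordered by `rA`, onto `T`, ordered by `rB`. -/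
def IsPosetIso (rA : A → A → Prop) (S : Set A) (rB : B → B → Prop) (T : Set B)
    (f : A → B) : Prop :=
  Set.BijOn f S T ∧ ∀ x ∈ S, ∀ y ∈ S, rA x y ↔ rB (f x) (f y)

/-- The order ideals of `P`, ordered by `r`: the subsets `J ⊆ P` that contain with `x` every
element of `P` below `x`. The whole of `P` is one of them. -/
def orderIdeals (r : A → A → Prop) (P : Set A) : Set (Set A) :=
  {J | J ⊆ P ∧ ∀ x ∈ J, ∀ y ∈ P, r y x → y ∈ J}

end Posets

/-! ## The cylinder -/

/-- The cylinder `𝒞_ω = ℤ² / ℤω` with `ω = (m, -ℓ)`. -/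
def Cylinder (m ℓ : ℕ+) : Type :=
  (ℤ × ℤ) ⧸ AddSubgroup.zmultiples ((((m : ℕ) : ℤ), -((ℓ : ℕ) : ℤ)) : ℤ × ℤ)

instance (m ℓ : ℕ+) : AddCommGroup (Cylinder m ℓ) :=
  inferInstanceAs (AddCommGroup
    ((ℤ × ℤ) ⧸ AddSubgroup.zmultiples ((((m : ℕ) : ℤ), -((ℓ : ℕ) : ℤ)) : ℤ × ℤ)))

variable {m ℓ : ℕ+}

/-- The projection `π : ℤ² → 𝒞_ω`. -/
def proj : ℤ × ℤ →+ Cylinder m ℓ :=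
  QuotientAddGroup.mk' (AddSubgroup.zmultiples ((((m : ℕ) : ℤ), -((ℓ : ℕ) : ℤ)) : ℤ × ℤ))

theorem proj_eq_proj_iff (p q : ℤ × ℤ) :
    (proj p : Cylinder m ℓ) = proj q ↔
      ∃ k : ℤ, q = (p.1 + k * ((m : ℕ) : ℤ), p.2 - k * ((ℓ : ℕ) : ℤ)) := by
  refine (QuotientAddGroup.eq (s := AddSubgroup.zmultiples
    ((((m : ℕ) : ℤ), -((ℓ : ℕ) : ℤ)) : ℤ × ℤ))).trans ?_
  rw [AddSubgroup.mem_zmultiples_iff]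
  constructor
  · rintro ⟨k, hk⟩
    refine ⟨k, ?_⟩
    have h1 := congrArg Prod.fst hk
    have h2 := congrArg Prod.snd hk
    simp at h1 h2
    ext <;> simp <;> linarith
  · rintro ⟨k, rfl⟩
    refine ⟨k, ?_⟩
    ext <;> simp
    ring

/-- `x ≤ y` holds if there are lifts `(a, b)` of `x` and `(a', b')` of `y` with `a ≥ a'` and
`b ≥ b'`. -/
instance : PartialOrder (Cylinder m ℓ) where
  le x y := ∃ p q : ℤ × ℤ, proj p = x ∧ proj q = y ∧ p.1 ≥ q.1 ∧ p.2 ≥ q.2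
  le_refl x := by
    obtain ⟨p, rfl⟩ := QuotientAddGroup.mk'_surjective _ x
    exact ⟨p, p, rfl, rfl, le_rfl, le_rfl⟩
  le_trans := by
    rintro x y z ⟨p, q, rfl, rfl, h1, h2⟩ ⟨q', r, hq, rfl, h3, h4⟩
    obtain ⟨k, rfl⟩ := (proj_eq_proj_iff q' q).1 hq
    refine ⟨p, (r.1 + k * ((m : ℕ) : ℤ), r.2 - k * ((ℓ : ℕ) : ℤ)), rfl,
      ((proj_eq_proj_iff _ _).2 ⟨k, rfl⟩).symm, ?_, ?_⟩
    · simp only at h1 h3 ⊢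
      linarith
    · simp only at h2 h4 ⊢
      linarith
  le_antisymm := by
    rintro x y ⟨p, q, rfl, rfl, h1, h2⟩ ⟨q', p', hq, hp, h3, h4⟩
    obtain ⟨k, rfl⟩ := (proj_eq_proj_iff q' q).1 hq
    obtain ⟨j, rfl⟩ := (proj_eq_proj_iff p' p).1 hp
    simp only at h1 h2 h3 h4
    have hm : (0 : ℤ) < ((m : ℕ) : ℤ) := by exact_mod_cast m.pos
    have hl : (0 : ℤ) < ((ℓ : ℕ) : ℤ) := by exact_mod_cast ℓ.pos
    have e1 : k ≤ j := by
      by_contra h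
      nlinarith [not_le.1 h]
    have e2 : j ≤ k := by
      by_contra h
      nlinarith [not_le.1 h]
    obtain rfl := le_antisymm e1 e2
    rw [proj_eq_proj_iff]
    refine ⟨0, ?_⟩
    ext <;> simp <;> linarith

theorem le_def (x y : Cylinder m ℓ) :
    x ≤ y ↔ ∃ p q : ℤ × ℤ, proj p = x ∧ proj q = y ∧ p.1 ≥ q.1 ∧ p.2 ≥ q.2 := Iff.rfl

/-- `κ = m + ℓ`. -/
abbrev kappa (m ℓ : ℕ+) : ℕ := (m : ℕ) + (ℓ : ℕ)

/-- The content map `(a, b) ↦ b - a mod κ`. -/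
def content : Cylinder m ℓ →+ ZMod (kappa m ℓ) :=
  QuotientAddGroup.lift (AddSubgroup.zmultiples ((((m : ℕ) : ℤ), -((ℓ : ℕ) : ℤ)) : ℤ × ℤ))
    ((Int.castAddHom (ZMod (kappa m ℓ))).comp (AddMonoidHom.snd ℤ ℤ - AddMonoidHom.fst ℤ ℤ))
    (by
      rw [AddSubgroup.zmultiples_le]
      have h : (((m : ℕ) + (ℓ : ℕ) : ℕ) : ZMod (kappa m ℓ)) = 0 := ZMod.natCast_self _
      push_cast at h
      simp only [AddMonoidHom.mem_ker, AddMonoidHom.comp_apply, AddMonoidHom.sub_apply,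
        AddMonoidHom.coe_snd, AddMonoidHom.coe_fst, Int.coe_castAddHom]
      push_cast
      linear_combination -h)

theorem content_proj (a b : ℤ) :
    content (proj (a, b) : Cylinder m ℓ) = ((b - a : ℤ) : ZMod (kappa m ℓ)) := rfl

/-! ## Cylindric diagrams -/

/-- A cylindric diagram is a non-trivial order filter of the cylinder. -/
def IsCylindricDiagram (θ : Set (Cylinder m ℓ)) : Prop :=
  IsUpperSet θ ∧ θ ≠ ∅ ∧ θ ≠ Set.univ

/-- `ℐ(θ)`, the set of proper order ideals of `θ`, that is, of the cylindric skew diagrams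
included in `θ` as order ideals. -/
def properOrderIdeals (θ : Set (Cylinder m ℓ)) : Set (Set (Cylinder m ℓ)) :=
  {ξ | ξ ∈ orderIdeals (· ≤ ·) θ ∧ ξ ≠ θ}

/-- The arm of `x` in `θ`. -/
def arm (θ : Set (Cylinder m ℓ)) (x : Cylinder m ℓ) : Set (Cylinder m ℓ) :=
  {y | y ∈ θ ∧ ∃ k : ℕ, 1 ≤ k ∧ y = x + proj (0, (k : ℤ))}

/-- The leg of `x` in `θ`. -/
def leg (θ : Set (Cylinder m ℓ)) (x : Cylinder m ℓ) : Set (Cylinder m ℓ) :=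
  {y | y ∈ θ ∧ ∃ k : ℕ, 1 ≤ k ∧ y = x + proj ((k : ℤ), 0)}

theorem IsCylindricDiagram.arm_finite {θ : Set (Cylinder m ℓ)} (hθ : IsCylindricDiagram θ)
    (x : Cylinder m ℓ) : (arm θ x).Finite := by
  obtain ⟨hup, -, hne⟩ := hθ
  obtain ⟨z, hz⟩ := (Set.ne_univ_iff_exists_notMem θ).1 hne
  obtain ⟨⟨a, b⟩, rfl⟩ := QuotientAddGroup.mk'_surjective _ x
  obtain ⟨⟨c, d⟩, rfl⟩ := QuotientAddGroup.mk'_surjective _ z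
  have hm : (1 : ℤ) ≤ ((m : ℕ) : ℤ) := by exact_mod_cast m.pos
  refine ((Set.finite_Iic (d - b + |c - a| * ((ℓ : ℕ) : ℤ)).toNat).image
    fun k : ℕ => (proj (a, b) + proj (0, (k : ℤ)) : Cylinder m ℓ)).subset ?_
  rintro y ⟨hy, k, -, rfl⟩
  refine ⟨k, ?_, rfl⟩
  by_contra hk
  refine hz (hup ?_ hy)
  refine ⟨(a + |c - a| * ((m : ℕ) : ℤ), b + k - |c - a| * ((ℓ : ℕ) : ℤ)), (c, d), ?_, rfl, ?_, ?_⟩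
  · refine ((proj_eq_proj_iff (a, b + (k : ℤ)) _).2 ⟨|c - a|, rfl⟩).symm.trans ?_
    refine Eq.trans ?_ (map_add (proj (m := m) (ℓ := ℓ)) (a, b) (0, (k : ℤ)))
    simp
  · have := le_abs_self (c - a)
    have := abs_nonneg (c - a)
    simp only
    nlinarith
  · simp only [Set.mem_Iic, not_le] at hk
    simp only
    have := Int.self_le_toNat (d - b + |c - a| * ((ℓ : ℕ) : ℤ))
    have h2 : (((d - b + |c - a| * ((ℓ : ℕ) : ℤ)).toNat : ℕ) : ℤ) < (k : ℤ) := by exact_mod_cast hk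
    linarith

theorem IsCylindricDiagram.leg_finite {θ : Set (Cylinder m ℓ)} (hθ : IsCylindricDiagram θ)
    (x : Cylinder m ℓ) : (leg θ x).Finite := by
  obtain ⟨hup, -, hne⟩ := hθ
  obtain ⟨z, hz⟩ := (Set.ne_univ_iff_exists_notMem θ).1 hne
  obtain ⟨⟨a, b⟩, rfl⟩ := QuotientAddGroup.mk'_surjective _ x
  obtain ⟨⟨c, d⟩, rfl⟩ := QuotientAddGroup.mk'_surjective _ z
  have hl : (1 : ℤ) ≤ ((ℓ : ℕ) : ℤ) := by exact_mod_cast ℓ.pos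
  refine ((Set.finite_Iic (c - a + |d - b| * ((m : ℕ) : ℤ)).toNat).image
    fun k : ℕ => (proj (a, b) + proj ((k : ℤ), 0) : Cylinder m ℓ)).subset ?_
  rintro y ⟨hy, k, -, rfl⟩
  refine ⟨k, ?_, rfl⟩
  by_contra hk
  refine hz (hup ?_ hy)
  refine ⟨(a + k + -|d - b| * ((m : ℕ) : ℤ), b - -|d - b| * ((ℓ : ℕ) : ℤ)), (c, d), ?_, rfl, ?_, ?_⟩
  · refine ((proj_eq_proj_iff (a + (k : ℤ), b) _).2 ⟨-|d - b|, rfl⟩).symm.trans ?_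
    refine Eq.trans ?_ (map_add (proj (m := m) (ℓ := ℓ)) (a, b) ((k : ℤ), 0))
    simp
  · simp only [Set.mem_Iic, not_le] at hk
    simp only
    have := Int.self_le_toNat (c - a + |d - b| * ((m : ℕ) : ℤ))
    have h2 : (((c - a + |d - b| * ((m : ℕ) : ℤ)).toNat : ℕ) : ℤ) < (k : ℤ) := by exact_mod_cast hk
    linarith
  · have := le_abs_self (d - b)
    have := abs_nonneg (d - b)
    simp only
    nlinarith

variable (𝕂 : Type*) [Field 𝕂]

/-- The simple root `α(x)` attached to a cell `x`. -/
def cellRoot (x : Cylinder m ℓ) : CartanDual 𝕂 (kappa m ℓ) := simpleRoot 𝕂 (content x)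

/-- The simple reflection `s(x)` attached to a cell `x`. -/
def cellReflection (x : Cylinder m ℓ) : weylGroup 𝕂 (kappa m ℓ) := s 𝕂 (content x)

/-- The colored hook length of `x` in the cylindric diagram `θ` (arms and legs are finite). -/
def hk (θ : Set (Cylinder m ℓ)) (x : Cylinder m ℓ) : CartanDual 𝕂 (kappa m ℓ) :=
  cellRoot 𝕂 x + ∑ᶠ y ∈ arm θ x, cellRoot 𝕂 y + ∑ᶠ y ∈ leg θ x, cellRoot 𝕂 y

/-- The bottom set `Γ` of `θ`: the minimum elements of the fibres of the content map on `θ`. -/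
def bottomSet (θ : Set (Cylinder m ℓ)) : Set (Cylinder m ℓ) :=
  {b | IsLeast {x | x ∈ θ ∧ content x = content b} b}

/-- The maximal elements of the bottom set. -/
def bottomMax (θ : Set (Cylinder m ℓ)) : Set (Cylinder m ℓ) :=
  {x | Maximal (· ∈ bottomSet θ) x}

/-- The minimal elements of the bottom set. -/
def bottomMin (θ : Set (Cylinder m ℓ)) : Set (Cylinder m ℓ) :=
  {x | Minimal (· ∈ bottomSet θ) x}

/-- The set `Π_θ`, the union of `Π_θ^0`, `Π_θ^arm` and `Π_θ^leg`. -/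
def cylindricSimple (θ : Set (Cylinder m ℓ)) : Set (CartanDual 𝕂 (kappa m ℓ)) :=
  cellRoot 𝕂 '' (bottomSet θ \ (bottomMax θ ∪ bottomMin θ)) ∪
  (fun x => cellRoot 𝕂 x + ∑ᶠ y ∈ arm θ x, cellRoot 𝕂 y) '' bottomMax θ ∪
  (fun x => cellRoot 𝕂 x + ∑ᶠ y ∈ leg θ x, cellRoot 𝕂 y) '' bottomMax θ

variable {𝕂}

/-- The order `α ≤^cyl β`: the difference `β - α` is a nonnegative integer combination of
elements of `Π_θ`. -/
def cylLE (θ : Set (Cylinder m ℓ)) (α β : CartanDual 𝕂 (kappa m ℓ)) : Prop :=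
  β - α ∈ AddSubmonoid.closure (cylindricSimple 𝕂 θ)

/-! ## Standard tableaux, heaps and Weyl group elements -/

/-- A (reverse) standard tableau on a finite set `ξ` of `n` cells: a bijection `ξ → [1, n]`
that is strictly increasing. -/
structure StandardTableau (ξ : Set (Cylinder m ℓ)) where
  toEquiv : ξ ≃ Set.Icc 1 ξ.ncard
  lt_of_lt : ∀ x y : ξ, x < y → toEquiv x < toEquiv y

variable {ξ : Set (Cylinder m ℓ)}

/-- The cell with entry `k`. -/
def StandardTableau.cell (t : StandardTableau ξ) (k : Set.Icc 1 ξ.ncard) : Cylinder m ℓ :=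
  (t.toEquiv.symm k : Cylinder m ℓ)

variable (𝕂)

/-- `w_{ξ,t} = s(t⁻¹(1)) s(t⁻¹(2)) ⋯ s(t⁻¹(n))`. -/
def StandardTableau.weylElement (t : StandardTableau ξ) : weylGroup 𝕂 (kappa m ℓ) :=
  (List.ofFn fun k : Fin ξ.ncard =>
    cellReflection 𝕂 (t.cell ⟨(k : ℕ) + 1, Nat.succ_le_succ (Nat.zero_le _), k.2⟩)).prod

/-- The heap order on `[1, n]`: the transitive closure of the relations `a ⪯ b` for `a ≤ b` such
that `s_{i_a} s_{i_b} ≠ s_{i_b} s_{i_a}` or `i_a = i_b`, where `i_k` is the content of the cell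
with entry `k`. -/
def StandardTableau.heapLE (t : StandardTableau ξ) :
    Set.Icc 1 ξ.ncard → Set.Icc 1 ξ.ncard → Prop :=
  Relation.TransGen fun a b => a ≤ b ∧
    (cellReflection 𝕂 (t.cell a) * cellReflection 𝕂 (t.cell b) ≠
        cellReflection 𝕂 (t.cell b) * cellReflection 𝕂 (t.cell a) ∨
      content (t.cell a) = content (t.cell b))

open Classical in
/-- The Weyl group element `w_ξ`, defined from a chosen standard tableau on `ξ`. -/
def weylElement (ξ : Set (Cylinder m ℓ)) : weylGroup 𝕂 (kappa m ℓ) :=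
  if h : Nonempty (StandardTableau ξ) then h.some.weylElement 𝕂 else 1

end CylindricDiagram

end

open CylindricDiagram

/-!
A cylindric diagram `θ` is encoded by its boundary, a periodic lattice path with steps indexed by
`ℤ`. Each step ends one row or one column of `ℤ²`, and each row and each column is ended by exactly
one step (`stepLabel`). On the side of the roots, let `E : ℤ → 𝔥^*` be the function `rootSum`, with
`E (p + 1) - E p = α_p`. The reflection `s_i` acts on the differences `E q - E p` through the affine
transposition that exchanges `p` and `p + 1` for all `p ≡ i`
(`simpleReflectionGL_rootSum_sub`). Hence the real roots are such differences, and the sign of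
`E q - E p` is that of `q - p`.

The two pictures fit together as follows. The colored hook length of a cell is `E r - E c`, where
`r` ends its row and `c` ends its column (`hk_proj`). Removing a minimal cell of content `i` from a
diagram changes the labels of the steps by the same affine transposition as `s_i`
(`stepLabel_removeCorner`). So, for an order ideal `η` of `θ`, the element `w_η` carries the
boundary of `θ \ η` to the boundary of `θ` (`listElement_rootSum_sub`).

* If `x` is a minimal cell of `θ \ η`, then `w_η α(x)` is the hook of `x` in `θ`. Adding the cells
  of `ξ` one at a time gives `R(w_ξ) = {h(x) | x ∈ ξ}`, with as many elements as `ξ`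
  (`inversionSet_listElement`), and therefore `ℓ(w_ξ) = |ξ|`.
* The set `Π_θ` consists of the differences of `E` between the ends of neighbouring rows and between
  those of neighbouring columns (`mem_cylindricSimple_iff`). This makes the hook map an
  order embedding (`le_iff_cylLE_hk`): if `x ≤ y`, the difference of the hooks is visibly a sum of
  such elements. For the converse, let `(a, b)` and `(a', b')` be lifts of `x` and `y`. A linear
  form chosen for these, nonnegative on `Π_θ`, takes the value `⌊(a - a') / m⌋ + ⌊(b - b') / ℓ⌋` on
  the difference of the hooks, and this is nonnegative only if `x ≤ y`.
* If `w_η α_i` is negative, the steps of `θ \ η` at `i` and `i + 1` belong to a row and a column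
  that cross in a maximal cell of `η` with content `i` (`exists_maximal_of_descent`). So going down
  in the weak order from `w_ξ` means removing cells (`exists_of_weakLE`), which identifies
  `[e, w_ξ]` with the order ideals of `ξ`.
* Cells are comparable if their contents are equal or neighbours (`le_or_le_of_content`), so the
  reflections of incomparable cells commute. This gives the independence of `w_ξ` of the tableau
  (`listElement_eq`) and the description of the order by heaps
  (`StandardTableau.isPosetIso_heapLE`).
-/

noncomputable section

namespace CylindricDiagram

/-! ### Real roots and inversion sets in type `A^{(1)}` -/

section AffineRoots

variable (𝕂 : Type*) [Field 𝕂] {κ : ℕ}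

theorem one_ne_zero_of_two_le (hκ : 2 ≤ κ) : (1 : ZMod κ) ≠ 0 := by
  have : Fact (1 < κ) := ⟨hκ⟩
  exact one_ne_zero

/-- A uniform formula for the Cartan matrix. For `κ = 2` the two neighbours `i ± 1` of `i`
coincide, and their contributions add up to the entry `-2`. -/
theorem cartanEntry_eq (hκ : 2 ≤ κ) (i j : ZMod κ) :
    cartanEntry i j = (if j = i then 2 else 0) - (if j = i - 1 then 1 else 0)
      - (if j = i + 1 then 1 else 0) := by
  have h1 : (1 : ZMod κ) ≠ 0 := one_ne_zero_of_two_le hκ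
  have e1 : (i - j = 1) ↔ j = i - 1 := by
    constructor <;> intro h <;> linear_combination -h
  have e2 : (i - j = -1) ↔ j = i + 1 := by
    constructor <;> intro h <;> linear_combination -h
  have n1 : i ≠ i - 1 := fun h => h1 (by linear_combination h)
  have n2 : i ≠ i + 1 := fun h => h1 (by linear_combination -h)
  unfold cartanEntry
  simp only [e1, e2]
  by_cases hij : i = j
  · subst hij
    simp [n1, n2]
  rw [if_neg hij, if_neg (Ne.symm hij)]
  by_cases h2 : κ = 2
  · subst h2
    have e3 : i - 1 = i + 1 := by clear e1 e2 n1 n2 hij; revert i; decide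
    have e4 : j = i + 1 := by
      clear e1 e2 n1 n2 e3
      revert i j
      decide
    simp [e4, e3]
  have h3 : (2 : ZMod κ) ≠ 0 := by
    intro h
    have : ((2 : ℕ) : ZMod κ) = 0 := by exact_mod_cast h
    rw [ZMod.natCast_eq_zero_iff] at this
    exact h2 (le_antisymm (Nat.le_of_dvd (by norm_num) this) hκ)
  have h4 : i - 1 ≠ i + 1 := fun h => h3 (by linear_combination -h)
  rw [if_neg h2]
  by_cases h5 : j = i - 1
  · subst h5
    simp [h4]
  · by_cases h6 : j = i + 1
    · subst h6
      simp [h4.symm]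
    · simp [h5, h6]

/-- Along the cycle `ℤ/κℤ`, pairing a linear relation with the coroots makes its coefficients an
arithmetic progression, hence constant in characteristic zero, and pairing it with `d` makes the
constant vanish. -/
theorem linearIndependent_simpleRoot [CharZero 𝕂] (hκ : 2 ≤ κ) :
    LinearIndependent 𝕂 (simpleRoot 𝕂 (κ := κ)) := by
  have : NeZero κ := ⟨by omega⟩
  rw [Fintype.linearIndependent_iff]
  intro c hc
  have hrec : ∀ i : ZMod κ, 2 * c i - c (i - 1) - c (i + 1) = 0 := by
    intro i
    have h := congrArg (fun f => f (simpleCoroot 𝕂 i)) hc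
    simpa [simpleRoot_simpleCoroot, cartanEntry_eq hκ, mul_sub, Finset.sum_sub_distrib,
      mul_comm] using h
  have hstep : ∀ n : ℕ, c ((n : ZMod κ) + 1) - c n = c 1 - c 0 := by
    intro n
    induction n with
    | zero => simp
    | succ n ih =>
      have h := hrec ((n : ZMod κ) + 1)
      rw [add_sub_cancel_right] at h
      push_cast
      linear_combination ih - h
  have hlin : ∀ n : ℕ, c (n : ZMod κ) = c 0 + n * (c 1 - c 0) := by
    intro n
    induction n with
    | zero => simp
    | succ n ih =>
      push_cast
      linear_combination hstep n + ih
  have hd : c 1 - c 0 = 0 := by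
    have h := hlin κ
    rw [ZMod.natCast_self] at h
    have h' : (κ : 𝕂) * (c 1 - c 0) = 0 := by linear_combination -h
    exact (mul_eq_zero.1 h').resolve_left (by exact_mod_cast (NeZero.ne κ))
  have hconst : ∀ i, c i = c 0 := by
    intro i
    have h := hlin i.val
    rwa [hd, mul_zero, add_zero, ZMod.natCast_zmod_val] at h
  have h0 : c 0 = 0 := by
    have h := congrArg (fun f => f (scalingElement 𝕂)) hc
    simpa [simpleRoot_scalingElement] using h
  exact fun i => (hconst i).trans h0

/-- A linear form on `𝔥^*` may be prescribed arbitrarily on the simple roots. -/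
theorem exists_form_simpleRoot [CharZero 𝕂] (hκ : 2 ≤ κ) (v : ZMod κ → 𝕂) :
    ∃ f : CartanDual 𝕂 κ →ₗ[𝕂] 𝕂, ∀ i, f (simpleRoot 𝕂 i) = v i := by
  have hli := linearIndependent_simpleRoot 𝕂 hκ
  obtain ⟨f, hf⟩ := LinearMap.exists_extend ((Module.Basis.span hli).constr 𝕂 v)
  refine ⟨f, fun i => ?_⟩
  have h1 := LinearMap.congr_fun hf (Module.Basis.span hli i)
  rw [Module.Basis.constr_basis] at h1
  rw [← h1, LinearMap.comp_apply, Submodule.subtype_apply, Module.Basis.span_apply]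

/-- The partial sums of the simple roots along `ℤ`, normalised by `rootSum 0 = 0`. The real roots
are the differences of two of its values, see `exists_of_mem_realRoots`. -/
def rootSum (p : ℤ) : CartanDual 𝕂 κ :=
  ∑ j ∈ Finset.Ico 0 p, simpleRoot 𝕂 (j : ZMod κ) - ∑ j ∈ Finset.Ico p 0, simpleRoot 𝕂 (j : ZMod κ)

theorem rootSum_add_one (p : ℤ) :
    rootSum 𝕂 (κ := κ) (p + 1) = rootSum 𝕂 p + simpleRoot 𝕂 (p : ZMod κ) := by
  unfold rootSum
  rcases le_or_gt 0 p with h | h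
  · rw [← Finset.insert_Ico_right_eq_Ico_add_one h, Finset.sum_insert (by simp),
      Finset.Ico_eq_empty (by omega : ¬ p < 0), Finset.Ico_eq_empty (by omega : ¬ p + 1 < 0)]
    simp [add_comm]
  · rw [← Finset.insert_Ico_add_one_left_eq_Ico h, Finset.sum_insert (by simp),
      Finset.Ico_eq_empty (by omega : ¬ 0 < p), Finset.Ico_eq_empty (by omega : ¬ 0 < p + 1)]
    simp

theorem rootSum_add_natCast (p : ℤ) (n : ℕ) :
    rootSum 𝕂 (κ := κ) (p + n) =
      rootSum 𝕂 p + ∑ k ∈ Finset.range n, simpleRoot 𝕂 ((p + k : ℤ) : ZMod κ) := by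
  induction n with
  | zero => simp
  | succ n ih =>
    rw [Finset.sum_range_succ, ← add_assoc, ← ih, Nat.cast_succ, ← add_assoc, rootSum_add_one]

theorem rootSum_sub_mem_rootCone {p q : ℤ} (h : p ≤ q) :
    rootSum 𝕂 q - rootSum 𝕂 p ∈ rootCone 𝕂 κ := by
  obtain ⟨n, rfl⟩ := Int.le.dest h
  rw [rootSum_add_natCast, add_sub_cancel_left]
  exact sum_mem fun k _ => AddSubmonoid.subset_closure ⟨_, rfl⟩

/-- A linear form takes on `rootSum q - rootSum p` the value `g q - g p`, if it is the increment
of `g` on the simple roots. -/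
theorem form_rootSum_sub {f : CartanDual 𝕂 κ →ₗ[𝕂] 𝕂} {g : ℤ → ℤ}
    (hf : ∀ p : ℤ, f (simpleRoot 𝕂 (p : ZMod κ)) = ((g (p + 1) - g p : ℤ) : 𝕂)) (p q : ℤ) :
    f (rootSum 𝕂 q - rootSum 𝕂 p) = ((g q - g p : ℤ) : 𝕂) := by
  have key : ∀ (p : ℤ) (n : ℕ),
      f (rootSum 𝕂 (p + n) - rootSum 𝕂 p) = ((g (p + n) - g p : ℤ) : 𝕂) := by
    intro p n
    induction n with
    | zero => simp
    | succ n ih =>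
      have := hf (p + n)
      rw [Nat.cast_succ, ← add_assoc, rootSum_add_one, add_sub_right_comm, map_add, ih, this]
      push_cast
      ring
  rcases le_total p q with h | h
  · obtain ⟨n, rfl⟩ := Int.le.dest h
    exact key p n
  · obtain ⟨n, rfl⟩ := Int.le.dest h
    have := key q n
    rw [← neg_sub, map_neg, this]
    push_cast
    ring

/-- The height form separates `Q_+` from `-Q_+`. -/
theorem exists_height [CharZero 𝕂] (hκ : 2 ≤ κ) : ∃ f : CartanDual 𝕂 κ →ₗ[𝕂] 𝕂,
    (∀ p q : ℤ, f (rootSum 𝕂 q - rootSum 𝕂 p) = ((q - p : ℤ) : 𝕂)) ∧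
    ∀ β ∈ rootCone 𝕂 κ, ∃ n : ℕ, f β = n := by
  obtain ⟨f, hf⟩ := exists_form_simpleRoot 𝕂 hκ (fun _ => 1)
  refine ⟨f, form_rootSum_sub 𝕂 (g := id) fun p => by simp [hf], fun β hβ => ?_⟩
  induction hβ using AddSubmonoid.closure_induction with
  | mem x hx =>
    obtain ⟨i, rfl⟩ := hx
    exact ⟨1, by simp [hf]⟩
  | zero => exact ⟨0, by simp⟩
  | add x y _ _ hx hy =>
    obtain ⟨a, ha⟩ := hx
    obtain ⟨b, hb⟩ := hy
    exact ⟨a + b, by simp [ha, hb]⟩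

theorem rootSum_sub_mem_rootCone_iff [CharZero 𝕂] (hκ : 2 ≤ κ) {p q : ℤ} :
    rootSum 𝕂 q - rootSum 𝕂 p ∈ rootCone 𝕂 κ ↔ p ≤ q := by
  refine ⟨fun h => ?_, rootSum_sub_mem_rootCone 𝕂⟩
  obtain ⟨f, hf, hc⟩ := exists_height 𝕂 hκ
  obtain ⟨n, hn⟩ := hc _ h
  rw [hf] at hn
  have : q - p = n := by exact_mod_cast hn
  omega

/-- The transposition of `ℤ` that exchanges `p` and `p + 1` whenever `p ≡ i`. -/
def affineSwap (i : ZMod κ) (p : ℤ) : ℤ :=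
  if (p : ZMod κ) = i then p + 1 else if (p : ZMod κ) = i + 1 then p - 1 else p

theorem rootSum_affineSwap (i : ZMod κ) (p : ℤ) :
    rootSum 𝕂 (κ := κ) (affineSwap i p) = rootSum 𝕂 p
      + (if (p : ZMod κ) = i then (1 : 𝕂) else if (p : ZMod κ) = i + 1 then -1 else 0)
        • simpleRoot 𝕂 i := by
  unfold affineSwap
  split_ifs with h1 h2
  · rw [rootSum_add_one, h1, one_smul]
  · have := rootSum_add_one 𝕂 (κ := κ) (p - 1)
    have h3 : ((p - 1 : ℤ) : ZMod κ) = i := by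
      push_cast
      rw [h2, add_sub_cancel_right]
    rw [sub_add_cancel, h3] at this
    rw [this]
    module
  · simp

/-- The affine Weyl group acts on the differences of `rootSum` by permutations of `ℤ`. -/
theorem simpleReflectionGL_rootSum_sub (hκ : 2 ≤ κ) (i : ZMod κ) (p q : ℤ) :
    simpleReflectionGL 𝕂 i (rootSum 𝕂 q - rootSum 𝕂 p) =
      rootSum 𝕂 (affineSwap i q) - rootSum 𝕂 (affineSwap i p) := by
  have h1 : (1 : ZMod κ) ≠ 0 := one_ne_zero_of_two_le hκ
  -- `g` is the potential on `ℤ` of which the pairing with `α_i^∨` is the increment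
  let g : ℤ → ℤ := fun p => if (p : ZMod κ) = i then -1 else if (p : ZMod κ) = i + 1 then 1 else 0
  have key := form_rootSum_sub 𝕂 (κ := κ)
    (f := Module.Dual.eval 𝕂 (Cartan 𝕂 κ) (simpleCoroot 𝕂 i)) (g := g) (fun p => by
      have e1 : (((p + 1 : ℤ)) : ZMod κ) = i ↔ (p : ZMod κ) = i - 1 := by
        push_cast
        exact ⟨fun h => by linear_combination h, fun h => by linear_combination h⟩
      have e2 : (((p + 1 : ℤ)) : ZMod κ) = i + 1 ↔ (p : ZMod κ) = i := by
        push_cast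
        exact ⟨fun h => by linear_combination h, fun h => by linear_combination h⟩
      have n1 : i ≠ i - 1 := fun h => h1 (by linear_combination h)
      have n2 : i ≠ i + 1 := fun h => h1 (by linear_combination -h)
      simp only [Module.Dual.eval_apply, simpleRoot_simpleCoroot, cartanEntry_eq hκ, g, e1, e2]
      by_cases h3 : (p : ZMod κ) = i
      · simp [h3, n1, n2]
      · by_cases h4 : (p : ZMod κ) = i - 1 <;> by_cases h5 : (p : ZMod κ) = i + 1 <;>
          simp [h3, h4, h5, n1.symm, n2.symm]
        split_ifs <;> norm_num) p q
  rw [Module.Dual.eval_apply] at key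
  rw [simpleReflectionGL_apply, key, rootSum_affineSwap, rootSum_affineSwap]
  have : ∀ p : ℤ, (if (p : ZMod κ) = i then (1 : 𝕂) else if (p : ZMod κ) = i + 1 then -1 else 0)
      = - ((g p : ℤ) : 𝕂) := by
    intro p
    simp only [g]
    split_ifs <;> simp
  rw [this, this]
  push_cast
  module

theorem affineSwap_involutive (hκ : 2 ≤ κ) (i : ZMod κ) (p : ℤ) :
    affineSwap i (affineSwap i p) = p := by
  have h1 : (1 : ZMod κ) ≠ 0 := one_ne_zero_of_two_le hκ
  unfold affineSwap
  split_ifs <;> push_cast at * <;> simp_all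

/-- Except on the pairs that it exchanges, `affineSwap i` is increasing. -/
theorem affineSwap_lt (hκ : 2 ≤ κ) (i : ZMod κ) {p q : ℤ} (hpq : p < q)
    (h : ¬ (q = p + 1 ∧ (p : ZMod κ) = i)) : affineSwap i p < affineSwap i q := by
  have h1 : (1 : ZMod κ) ≠ 0 := one_ne_zero_of_two_le hκ
  have hne : affineSwap i p ≠ affineSwap i q := fun h' => by
    have := congrArg (affineSwap i) h'
    rw [affineSwap_involutive hκ, affineSwap_involutive hκ] at this
    omega
  refine lt_of_le_of_ne ?_ hne
  unfold affineSwap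
  split_ifs with h2 h3 <;> try omega
  · have : q ≠ p + 1 := fun h' => h ⟨h', h2⟩
    omega

variable {𝕂}

theorem coe_mul_apply (v w : weylGroup 𝕂 κ) (ζ : CartanDual 𝕂 κ) : (v * w).1 ζ = v.1 (w.1 ζ) := rfl

theorem s_apply (i : ZMod κ) (ζ : CartanDual 𝕂 κ) : (s 𝕂 i).1 ζ = simpleReflectionGL 𝕂 i ζ := rfl

theorem s_mul_self (i : ZMod κ) : s 𝕂 i * s 𝕂 i = 1 := by
  ext1
  exact LinearEquiv.ext fun ζ => by
    change simpleReflectionGL 𝕂 i (simpleReflectionGL 𝕂 i ζ) = ζ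
    exact Module.involutive_reflection (eval_simpleCoroot_simpleRoot 𝕂 i) ζ

theorem simpleReflectionGL_self (i : ZMod κ) :
    simpleReflectionGL 𝕂 i (simpleRoot 𝕂 i) = - simpleRoot 𝕂 i :=
  Module.reflection_apply_self (eval_simpleCoroot_simpleRoot 𝕂 i)

theorem simpleRoot_eq_rootSum_sub (p : ℤ) :
    simpleRoot 𝕂 (p : ZMod κ) = rootSum 𝕂 (p + 1) - rootSum 𝕂 p := by
  rw [rootSum_add_one, add_sub_cancel_left]

theorem exists_of_mem_realRoots (hκ : 2 ≤ κ) {β : CartanDual 𝕂 κ} (hβ : β ∈ realRoots 𝕂 κ) :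
    ∃ p q : ℤ, p ≠ q ∧ β = rootSum 𝕂 q - rootSum 𝕂 p := by
  obtain ⟨⟨w, hw⟩, i, rfl⟩ := hβ
  have step : ∀ w : weylGroup 𝕂 κ, ∀ p q : ℤ, p ≠ q →
      ∃ p' q' : ℤ, p' ≠ q' ∧ w.1 (rootSum 𝕂 q - rootSum 𝕂 p) = rootSum 𝕂 q' - rootSum 𝕂 p' := by
    have hs : ∀ i : ZMod κ, ∀ p q : ℤ, p ≠ q → affineSwap i p ≠ affineSwap i q := by
      intro i p q hpq h'
      have := congrArg (affineSwap i) h'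
      rw [affineSwap_involutive hκ, affineSwap_involutive hκ] at this
      exact hpq this
    rintro ⟨w, hw⟩
    induction hw using Subgroup.closure_induction'' with
    | one => exact fun p q h => ⟨p, q, h, rfl⟩
    | mem x hx =>
      obtain ⟨i, rfl⟩ := hx
      intro p q h
      exact ⟨_, _, hs i p q h, simpleReflectionGL_rootSum_sub 𝕂 hκ i p q⟩
    | inv_mem x hx =>
      obtain ⟨i, rfl⟩ := hx
      intro p q h
      refine ⟨_, _, hs i p q h, ?_⟩
      have : (simpleReflectionGL 𝕂 i)⁻¹ = simpleReflectionGL 𝕂 i :=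
        inv_eq_of_mul_eq_one_left (congrArg Subtype.val (s_mul_self (𝕂 := 𝕂) i))
      simp only [this]
      exact simpleReflectionGL_rootSum_sub 𝕂 hκ i p q
    | mul x y _ _ hx hy =>
      intro p q h
      obtain ⟨p', q', h', e'⟩ := hy p q h
      obtain ⟨p'', q'', h'', e''⟩ := hx p' q' h'
      exact ⟨p'', q'', h'', (congrArg x e').trans e''⟩
  obtain ⟨n, rfl⟩ := ZMod.intCast_surjective i
  rw [simpleRoot_eq_rootSum_sub]
  exact step _ _ _ (by omega)

theorem mul_simpleRoot_mem_realRoots (w : weylGroup 𝕂 κ) (i : ZMod κ) :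
    w.1 (simpleRoot 𝕂 i) ∈ realRoots 𝕂 κ := ⟨w, i, rfl⟩

theorem map_mem_realRoots (w : weylGroup 𝕂 κ) {β : CartanDual 𝕂 κ} (hβ : β ∈ realRoots 𝕂 κ) :
    w.1 β ∈ realRoots 𝕂 κ := by
  obtain ⟨v, i, rfl⟩ := hβ
  exact ⟨w * v, i, rfl⟩

theorem mem_inversionSet {w : weylGroup 𝕂 κ} {β : CartanDual 𝕂 κ} :
    β ∈ inversionSet w ↔ ∃ γ ∈ realRoots 𝕂 κ, -γ ∈ rootCone 𝕂 κ ∧ w.1 γ = β ∧ β ∈ rootCone 𝕂 κ := by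
  constructor
  · rintro ⟨⟨h1, h2⟩, γ, ⟨h3, h4⟩, h5⟩
    exact ⟨γ, h3, h4, h5, h2⟩
  · rintro ⟨γ, h3, h4, rfl, h2⟩
    exact ⟨⟨map_mem_realRoots w h3, h2⟩, γ, ⟨h3, h4⟩, rfl⟩

theorem mem_or_neg_mem_rootCone (hκ : 2 ≤ κ) {β : CartanDual 𝕂 κ} (hβ : β ∈ realRoots 𝕂 κ) :
    β ∈ rootCone 𝕂 κ ∨ -β ∈ rootCone 𝕂 κ := by
  obtain ⟨p, q, -, rfl⟩ := exists_of_mem_realRoots hκ hβ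
  rw [neg_sub]
  exact (le_total p q).imp (rootSum_sub_mem_rootCone 𝕂) (rootSum_sub_mem_rootCone 𝕂)

theorem not_mem_and_neg_mem_rootCone [CharZero 𝕂] (hκ : 2 ≤ κ) {β : CartanDual 𝕂 κ}
    (hβ : β ∈ realRoots 𝕂 κ) (h1 : β ∈ rootCone 𝕂 κ) (h2 : -β ∈ rootCone 𝕂 κ) : False := by
  obtain ⟨p, q, h, rfl⟩ := exists_of_mem_realRoots hκ hβ
  rw [neg_sub] at h2
  rw [rootSum_sub_mem_rootCone_iff 𝕂 hκ] at h1 h2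
  omega

/-- A simple reflection `s_i` permutes the negative roots other than `-α_i`. -/
theorem neg_simpleReflectionGL_mem_rootCone [CharZero 𝕂] (hκ : 2 ≤ κ) (i : ZMod κ)
    {γ : CartanDual 𝕂 κ} (hγ : γ ∈ realRoots 𝕂 κ) (h : -γ ∈ rootCone 𝕂 κ)
    (hne : γ ≠ -simpleRoot 𝕂 i) : -simpleReflectionGL 𝕂 i γ ∈ rootCone 𝕂 κ := by
  obtain ⟨p, q, hpq, rfl⟩ := exists_of_mem_realRoots hκ hγ
  rw [neg_sub, rootSum_sub_mem_rootCone_iff 𝕂 hκ] at h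
  rw [simpleReflectionGL_rootSum_sub 𝕂 hκ, neg_sub, rootSum_sub_mem_rootCone_iff 𝕂 hκ]
  refine (affineSwap_lt hκ i (by omega) ?_).le
  rintro ⟨rfl, rfl⟩
  rw [simpleRoot_eq_rootSum_sub, neg_sub] at hne
  exact hne rfl

/-- If `w α_i` is positive, then `R(w s_i) = R(w) ⊔ {w α_i}`. -/
theorem inversionSet_mul_s [CharZero 𝕂] (hκ : 2 ≤ κ) (w : weylGroup 𝕂 κ) (i : ZMod κ)
    (h : w.1 (simpleRoot 𝕂 i) ∈ rootCone 𝕂 κ) :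
    inversionSet (w * s 𝕂 i) = insert (w.1 (simpleRoot 𝕂 i)) (inversionSet w) := by
  have hinv : ∀ ζ, simpleReflectionGL 𝕂 i (simpleReflectionGL 𝕂 i ζ) = ζ :=
    Module.involutive_reflection (eval_simpleCoroot_simpleRoot 𝕂 i)
  have hα : simpleRoot 𝕂 i ∈ rootCone 𝕂 κ := AddSubmonoid.subset_closure ⟨i, rfl⟩
  have hαr : simpleRoot 𝕂 i ∈ realRoots 𝕂 κ := ⟨1, i, rfl⟩
  have hpos := fun h' => not_mem_and_neg_mem_rootCone hκ (mul_simpleRoot_mem_realRoots w i) h h'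
  ext β
  rw [Set.mem_insert_iff, mem_inversionSet, mem_inversionSet]
  constructor
  · rintro ⟨γ, h1, h2, rfl, h3⟩
    by_cases hγ : γ = -simpleRoot 𝕂 i
    · left
      rw [hγ, coe_mul_apply, s_apply, map_neg, simpleReflectionGL_self, neg_neg]
    · right
      exact ⟨simpleReflectionGL 𝕂 i γ, map_mem_realRoots (s 𝕂 i) h1,
        neg_simpleReflectionGL_mem_rootCone hκ i h1 h2 hγ, rfl, h3⟩
  · rintro (rfl | ⟨γ, h1, h2, rfl, h3⟩)
    · refine ⟨-simpleRoot 𝕂 i, ?_, by rwa [neg_neg], ?_, h⟩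
      · rw [← simpleReflectionGL_self]
        exact map_mem_realRoots (s 𝕂 i) hαr
      · rw [coe_mul_apply, s_apply, map_neg, simpleReflectionGL_self, neg_neg]
    · refine ⟨simpleReflectionGL 𝕂 i γ, map_mem_realRoots (s 𝕂 i) h1,
        neg_simpleReflectionGL_mem_rootCone hκ i h1 h2 ?_, ?_, h3⟩
      · rintro rfl
        rw [map_neg] at h3
        exact hpos h3
      · rw [coe_mul_apply, s_apply, hinv]

theorem simpleRoot_notMem_inversionSet [CharZero 𝕂] (hκ : 2 ≤ κ) (w : weylGroup 𝕂 κ) (i : ZMod κ) :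
    w.1 (simpleRoot 𝕂 i) ∉ inversionSet w := by
  rw [mem_inversionSet]
  rintro ⟨γ, h1, h2, h3, h4⟩
  obtain rfl := w.1.injective h3
  exact not_mem_and_neg_mem_rootCone hκ h1 (AddSubmonoid.subset_closure ⟨i, rfl⟩) h2

theorem inversionSet_one [CharZero 𝕂] (hκ : 2 ≤ κ) : inversionSet (1 : weylGroup 𝕂 κ) = ∅ := by
  rw [Set.eq_empty_iff_forall_notMem]
  intro β hβ
  rw [mem_inversionSet] at hβ
  obtain ⟨γ, h1, h2, rfl, h4⟩ := hβ
  exact not_mem_and_neg_mem_rootCone hκ h1 h4 h2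

theorem inversionSet_mul_s_of_neg [CharZero 𝕂] (hκ : 2 ≤ κ) (w : weylGroup 𝕂 κ) (i : ZMod κ)
    (h : -w.1 (simpleRoot 𝕂 i) ∈ rootCone 𝕂 κ) :
    inversionSet w = insert (-w.1 (simpleRoot 𝕂 i)) (inversionSet (w * s 𝕂 i)) := by
  have e : (w * s 𝕂 i).1 (simpleRoot 𝕂 i) = -w.1 (simpleRoot 𝕂 i) := by
    rw [coe_mul_apply, s_apply, simpleReflectionGL_self, map_neg]
  have := inversionSet_mul_s hκ (w * s 𝕂 i) i (by rwa [e])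
  rwa [mul_assoc, s_mul_self, mul_one, e] at this

theorem encard_inversionSet_le [CharZero 𝕂] (hκ : 2 ≤ κ) (L : List (ZMod κ)) :
    (inversionSet (L.map (s 𝕂)).prod).encard ≤ L.length := by
  induction L using List.reverseRecOn with
  | nil => simp [inversionSet_one hκ]
  | append_singleton L i ih =>
    rw [List.map_append, List.prod_append, List.map_singleton, List.prod_singleton,
      List.length_append, List.length_singleton]
    set w := (L.map (s 𝕂)).prod
    push_cast
    rcases mem_or_neg_mem_rootCone hκ (mul_simpleRoot_mem_realRoots w i) with h | h
    · rw [inversionSet_mul_s hκ w i h]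
      exact (Set.encard_insert_le _ _).trans (by gcongr)
    · refine ((Set.encard_le_encard ?_).trans ih).trans le_self_add
      rw [inversionSet_mul_s_of_neg hκ w i h]
      exact Set.subset_insert _ _

theorem exists_word (w : weylGroup 𝕂 κ) : ∃ L : List (ZMod κ), (L.map (s 𝕂)).prod = w := by
  obtain ⟨w, hw⟩ := w
  induction hw using Subgroup.closure_induction'' with
  | one => exact ⟨[], rfl⟩
  | mem x hx =>
    obtain ⟨i, rfl⟩ := hx
    exact ⟨[i], by simp [s]⟩
  | inv_mem x hx =>
    obtain ⟨i, rfl⟩ := hx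
    refine ⟨[i], ?_⟩
    rw [List.map_singleton, List.prod_singleton]
    exact Subtype.ext
      (inv_eq_of_mul_eq_one_left (congrArg Subtype.val (s_mul_self (𝕂 := 𝕂) i))).symm
  | mul x y _ _ hx hy =>
    obtain ⟨L, hL⟩ := hx
    obtain ⟨M, hM⟩ := hy
    refine ⟨L ++ M, ?_⟩
    rw [List.map_append, List.prod_append, hL, hM]
    rfl

/-- Equality holds for all `w`, but only this half is needed: the elements that occur below come
with a word as long as their inversion set. -/
theorem encard_inversionSet_le_length [CharZero 𝕂] (hκ : 2 ≤ κ) (w : weylGroup 𝕂 κ) :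
    (inversionSet w).encard ≤ length w := by
  have hne : {r | ∃ L : List (ZMod κ), L.length = r ∧ (L.map (s 𝕂)).prod = w}.Nonempty := by
    obtain ⟨L, hL⟩ := exists_word w
    exact ⟨_, L, rfl, hL⟩
  obtain ⟨L, h1, h2⟩ := Nat.sInf_mem hne
  have := encard_inversionSet_le (𝕂 := 𝕂) hκ L
  rwa [h1, h2] at this

theorem length_prod_le (L : List (ZMod κ)) : length (L.map (s 𝕂)).prod ≤ L.length :=
  Nat.sInf_le ⟨L, rfl, rfl⟩

theorem s_mul_comm_of_cartanEntry (hκ : 2 ≤ κ) {i j : ZMod κ} (h1 : j ≠ i - 1) (h2 : j ≠ i + 1) :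
    s 𝕂 i * s 𝕂 j = s 𝕂 j * s 𝕂 i := by
  by_cases hij : i = j
  · rw [hij]
  have e1 : cartanEntry i j = 0 := by
    simp [cartanEntry_eq hκ, h1, h2, Ne.symm hij]
  have h3 : i ≠ j - 1 := fun h => h2 (by linear_combination -h)
  have h4 : i ≠ j + 1 := fun h => h1 (by linear_combination -h)
  have e2 : cartanEntry j i = 0 := by
    simp [cartanEntry_eq hκ, h3, h4, hij]
  ext1
  refine LinearEquiv.ext fun ζ => ?_
  change simpleReflectionGL 𝕂 i (simpleReflectionGL 𝕂 j ζ)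
    = simpleReflectionGL 𝕂 j (simpleReflectionGL 𝕂 i ζ)
  simp only [simpleReflectionGL_apply, LinearMap.sub_apply, LinearMap.smul_apply,
    simpleRoot_simpleCoroot, e1, e2]
  simp
  abel

theorem s_mul_ne [CharZero 𝕂] (hκ : 2 ≤ κ) {i j : ZMod κ} (hij : i ≠ j)
    (h : cartanEntry i j ≠ 0) : s 𝕂 i * s 𝕂 j ≠ s 𝕂 j * s 𝕂 i := by
  intro hc
  have key : simpleReflectionGL 𝕂 i (simpleReflectionGL 𝕂 j (simpleRoot 𝕂 j))
      = simpleReflectionGL 𝕂 j (simpleReflectionGL 𝕂 i (simpleRoot 𝕂 j)) :=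
    congrArg (fun w : weylGroup 𝕂 κ => w.1 (simpleRoot 𝕂 j)) hc
  rw [simpleReflectionGL_self] at key
  obtain ⟨f, hf⟩ := exists_form_simpleRoot 𝕂 hκ (fun k => if k = i then 1 else 0)
  have := congrArg f key
  simp [simpleReflectionGL_apply, simpleRoot_simpleCoroot, hf, hij.symm] at this
  have h2 : ((2 * cartanEntry i j : ℤ) : 𝕂) = 0 := by
    push_cast
    linear_combination this
  have : 2 * cartanEntry i j = 0 := by exact_mod_cast h2
  omega

end AffineRoots

/-! ### Lifts of cells to `ℤ²` -/

section Lifts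

variable {m ℓ : ℕ+}

theorem two_le_kappa (m ℓ : ℕ+) : 2 ≤ kappa m ℓ := by
  have := m.pos
  have := ℓ.pos
  unfold kappa
  omega

theorem exists_lift (x : Cylinder m ℓ) : ∃ a b : ℤ, proj (a, b) = x := by
  obtain ⟨⟨a, b⟩, h⟩ := QuotientAddGroup.mk'_surjective _ x
  exact ⟨a, b, h⟩

theorem exists_diagonal_lift (x : Cylinder m ℓ) : ∃ u p : ℤ, proj (u, u + p) = x := by
  obtain ⟨a, b, rfl⟩ := exists_lift x
  exact ⟨a, b - a, by rw [add_sub_cancel]⟩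

theorem proj_add_mul (a b k : ℤ) : (proj (a + k * ((m : ℕ) : ℤ), b - k * ((ℓ : ℕ) : ℤ)) :
    Cylinder m ℓ) = proj (a, b) :=
  ((proj_eq_proj_iff (a, b) _).2 ⟨k, rfl⟩).symm

theorem proj_le_proj {a b a' b' : ℤ} (ha : a' ≤ a) (hb : b' ≤ b) :
    (proj (a, b) : Cylinder m ℓ) ≤ proj (a', b') :=
  ⟨_, _, rfl, rfl, ha, hb⟩

theorem proj_le_proj_iff {a b a' b' : ℤ} : (proj (a, b) : Cylinder m ℓ) ≤ proj (a', b') ↔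
    ∃ k : ℤ, a' ≤ a + k * ((m : ℕ) : ℤ) ∧ b' ≤ b - k * ((ℓ : ℕ) : ℤ) := by
  constructor
  · rintro ⟨p, q, hp, hq, h1, h2⟩
    obtain ⟨j, rfl⟩ := (proj_eq_proj_iff (a, b) p).1 hp.symm
    obtain ⟨k, rfl⟩ := (proj_eq_proj_iff (a', b') q).1 hq.symm
    simp only [ge_iff_le] at h1 h2
    exact ⟨j - k, by linarith, by linarith⟩
  · rintro ⟨k, h1, h2⟩
    rw [← proj_add_mul a b k]
    exact proj_le_proj h1 h2

/-- The antisymmetry of the order, for given lifts. -/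
theorem eq_of_proj_le_proj {a b a' b' : ℤ} (h : (proj (a, b) : Cylinder m ℓ) ≤ proj (a', b'))
    (ha : a ≤ a') (hb : b ≤ b') : a = a' ∧ b = b' := by
  obtain ⟨k, h1, h2⟩ := proj_le_proj_iff.1 h
  have hm : (0 : ℤ) < ((m : ℕ) : ℤ) := by exact_mod_cast m.pos
  have hl : (0 : ℤ) < ((ℓ : ℕ) : ℤ) := by exact_mod_cast ℓ.pos
  have h3 : 0 ≤ k := by
    by_contra h'
    nlinarith
  have h4 : k ≤ 0 := by
    by_contra h'
    nlinarith
  obtain rfl := le_antisymm h4 h3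
  constructor <;> linarith

/-- Every element above `proj (a, b)` has a lift in the upper left quadrant at `(a, b)`. -/
theorem exists_lift_of_le {a b : ℤ} {y : Cylinder m ℓ} (h : proj (a, b) ≤ y) :
    ∃ u p : ℤ, proj (u, u + p) = y ∧ u ≤ a ∧ u + p ≤ b := by
  obtain ⟨v, q, rfl⟩ := exists_diagonal_lift y
  obtain ⟨k, h1, h2⟩ := proj_le_proj_iff.1 h
  refine ⟨v + (-k) * ((m : ℕ) : ℤ), q + k * ((m : ℕ) : ℤ) + k * ((ℓ : ℕ) : ℤ), ?_, by linarith,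
    by linarith⟩
  rw [← proj_add_mul v (v + q) (-k)]
  congr 1
  ext
  · rfl
  · simp only
    ring

/-- Every element below `proj (a, b)` has a lift in the lower right quadrant at `(a, b)`. -/
theorem exists_lift_of_ge {a b : ℤ} {y : Cylinder m ℓ} (h : y ≤ proj (a, b)) :
    ∃ u p : ℤ, proj (u, u + p) = y ∧ a ≤ u ∧ b ≤ u + p := by
  obtain ⟨v, q, rfl⟩ := exists_diagonal_lift y
  obtain ⟨k, h1, h2⟩ := proj_le_proj_iff.1 h
  refine ⟨v + k * ((m : ℕ) : ℤ), q - k * ((m : ℕ) : ℤ) - k * ((ℓ : ℕ) : ℤ), ?_, by linarith,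
    by linarith⟩
  rw [← proj_add_mul v (v + q) k]
  congr 1
  ext
  · rfl
  · simp only
    ring

theorem intCast_eq_iff_exists {p q : ℤ} : (q : ZMod (kappa m ℓ)) = p ↔
    ∃ k : ℤ, q = p + k * (((m : ℕ) : ℤ) + ((ℓ : ℕ) : ℤ)) := by
  rw [eq_comm, ZMod.intCast_eq_intCast_iff_dvd_sub]
  constructor
  · rintro ⟨k, hk⟩
    refine ⟨k, ?_⟩
    push_cast at hk
    linear_combination hk
  · rintro ⟨k, rfl⟩
    exact ⟨k, by push_cast; ring⟩

theorem content_diagonal (u p : ℤ) :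
    content (proj (u, u + p) : Cylinder m ℓ) = (p : ZMod (kappa m ℓ)) := by
  rw [content_proj, add_sub_cancel_left]

/-- Cells with the same content have lifts on the same diagonal. -/
theorem exists_lift_of_content {x : Cylinder m ℓ} {p : ℤ}
    (h : content x = (p : ZMod (kappa m ℓ))) : ∃ u : ℤ, proj (u, u + p) = x := by
  obtain ⟨v, q, rfl⟩ := exists_diagonal_lift x
  rw [content_diagonal, intCast_eq_iff_exists] at h
  obtain ⟨k, rfl⟩ := h
  refine ⟨v + k * ((m : ℕ) : ℤ), ?_⟩
  rw [← proj_add_mul v _ k]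
  congr 1
  ext
  · rfl
  · simp only
    ring

end Lifts

/-! ### The boundary path of a cylindric diagram -/

section Profiles

variable {m ℓ : ℕ+}

/-- `t` is the profile of `θ`: the cells of `θ` on the diagonal `b - a = p` of `ℤ²` are those
with first coordinate at most `t p`. -/
def IsProfile (θ : Set (Cylinder m ℓ)) (t : ℤ → ℤ) : Prop :=
  ∀ u p : ℤ, (proj (u, u + p) : Cylinder m ℓ) ∈ θ ↔ u ≤ t p

variable (m ℓ) in
/-- The functions on `ℤ` that are profiles of cylindric diagrams. Such a function `t` encodes an
infinite periodic lattice path, the boundary of the diagram, whose step at `p` is vertical if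
`t p = t (p - 1) - 1` and horizontal if `t p = t (p - 1)`. -/
structure IsPath (t : ℤ → ℤ) : Prop where
  succ_le : ∀ p, t (p + 1) ≤ t p
  le_succ : ∀ p, t p ≤ t (p + 1) + 1
  shift : ∀ p k : ℤ, t (p + k * (((m : ℕ) : ℤ) + ((ℓ : ℕ) : ℤ))) = t p - k * ((m : ℕ) : ℤ)

theorem IsProfile.mem_iff {θ : Set (Cylinder m ℓ)} {t : ℤ → ℤ} (ht : IsProfile θ t) (a b : ℤ) :
    (proj (a, b) : Cylinder m ℓ) ∈ θ ↔ a ≤ t (b - a) := by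
  rw [← ht a (b - a), add_sub_cancel]

theorem IsProfile.isPath {θ : Set (Cylinder m ℓ)} {t : ℤ → ℤ} (ht : IsProfile θ t)
    (hθ : IsUpperSet θ) : IsPath m ℓ t where
  succ_le p := by
    rw [← ht]
    refine hθ (proj_le_proj le_rfl ?_) ((ht (t (p + 1)) (p + 1)).2 le_rfl)
    linarith
  le_succ p := by
    have : t p - 1 ≤ t (p + 1) := by
      rw [← ht]
      exact hθ (proj_le_proj (by linarith) (by linarith)) ((ht (t p) p).2 le_rfl)
    linarith
  shift p k := by
    have key : ∀ u : ℤ, u ≤ t (p + k * (((m : ℕ) : ℤ) + ((ℓ : ℕ) : ℤ))) ↔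
        u + k * ((m : ℕ) : ℤ) ≤ t p := by
      intro u
      rw [← ht, ← ht, ← proj_add_mul u _ k]
      have : u + (p + k * (((m : ℕ) : ℤ) + ((ℓ : ℕ) : ℤ))) - k * ((ℓ : ℕ) : ℤ) =
        u + k * ((m : ℕ) : ℤ) + p := by ring
      rw [this]
    refine le_antisymm ?_ ?_
    · have := (key _).1 le_rfl
      linarith
    · rw [key, sub_add_cancel]

theorem IsCylindricDiagram.exists_profile {θ : Set (Cylinder m ℓ)} (hθ : IsCylindricDiagram θ) :
    ∃ t, IsProfile θ t ∧ IsPath m ℓ t := by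
  obtain ⟨hup, hne, hne'⟩ := hθ
  obtain ⟨x, hx⟩ := Set.nonempty_iff_ne_empty.2 hne
  obtain ⟨z, hz⟩ := (Set.ne_univ_iff_exists_notMem θ).1 hne'
  obtain ⟨a, b, rfl⟩ := exists_lift x
  obtain ⟨c, d, rfl⟩ := exists_lift z
  have key : ∀ p : ℤ, ∃ t : ℤ, ∀ u : ℤ, (proj (u, u + p) : Cylinder m ℓ) ∈ θ ↔ u ≤ t := by
    intro p
    obtain ⟨t, h1, h2⟩ := Int.exists_greatest_of_bdd
      (P := fun u => (proj (u, u + p) : Cylinder m ℓ) ∈ θ)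
      ⟨max c (d - p), fun u hu => by
        by_contra h
        rw [not_le, max_lt_iff] at h
        exact hz (hup (proj_le_proj (by linarith) (by linarith)) hu)⟩
      ⟨min a (b - p), hup (proj_le_proj (min_le_left _ _)
        (by linarith [min_le_right a (b - p)])) hx⟩
    exact ⟨t, fun u => ⟨h2 u, fun hu => hup (proj_le_proj hu (by linarith)) h1⟩⟩
  choose t ht using key
  have ht' : IsProfile θ t := fun u p => ht p u
  exact ⟨t, ht', ht'.isPath hup⟩

theorem IsProfile.unique {θ : Set (Cylinder m ℓ)} {t t' : ℤ → ℤ} (ht : IsProfile θ t)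
    (ht' : IsProfile θ t') : t = t' := by
  funext p
  refine le_antisymm ?_ ?_
  · rw [← ht', ht]
  · rw [← ht, ht']

variable {t : ℤ → ℤ}

namespace IsPath

theorem antitone (ht : IsPath m ℓ t) : Antitone t :=
  antitone_int_of_succ_le ht.succ_le

theorem monotone (ht : IsPath m ℓ t) : Monotone fun p => p + t p :=
  monotone_int_of_le_succ fun p => by
    have := ht.le_succ p
    linarith

theorem sub_one (ht : IsPath m ℓ t) (p : ℤ) : t p ≤ t (p - 1) ∧ t (p - 1) ≤ t p + 1 := by
  have h1 := ht.succ_le (p - 1)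
  have h2 := ht.le_succ (p - 1)
  rw [sub_add_cancel] at h1 h2
  exact ⟨h1, h2⟩

end IsPath

/-- The step of the path `t` at `p`: the row of `ℤ²` that ends there, if it is vertical, or the
column that ends there, if it is horizontal. -/
def stepLabel (t : ℤ → ℤ) (p : ℤ) : ℤ ⊕ ℤ :=
  if t p < t (p - 1) then Sum.inl (t (p - 1)) else Sum.inr (p + t p)

namespace IsPath

theorem stepLabel_eq_inl (ht : IsPath m ℓ t) {p a : ℤ} :
    stepLabel t p = Sum.inl a ↔ t p < a ∧ a ≤ t (p - 1) := by
  have := ht.sub_one p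
  unfold stepLabel
  split_ifs with h
  · rw [Sum.inl.injEq]
    omega
  · simp only [false_iff]
    omega

theorem stepLabel_eq_inr (ht : IsPath m ℓ t) {p b : ℤ} :
    stepLabel t p = Sum.inr b ↔ p - 1 + t (p - 1) < b ∧ b ≤ p + t p := by
  have := ht.sub_one p
  unfold stepLabel
  split_ifs with h
  · simp only [false_iff]
    omega
  · rw [Sum.inr.injEq]
    omega

/-- The step that ends the row `a` separates the diagonals on which the cell of the row belongs
to the diagram from those on which it does not. -/
theorem lt_iff_of_inl (ht : IsPath m ℓ t) {r a : ℤ} (h : stepLabel t r = Sum.inl a) (p : ℤ) :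
    t p < a ↔ r ≤ p := by
  rw [ht.stepLabel_eq_inl] at h
  constructor
  · intro h'
    by_contra hlt
    have := ht.antitone (show p ≤ r - 1 by omega)
    omega
  · intro h'
    have := ht.antitone h'
    omega

theorem le_iff_of_inr (ht : IsPath m ℓ t) {c b : ℤ} (h : stepLabel t c = Sum.inr b) (p : ℤ) :
    b ≤ p + t p ↔ c ≤ p := by
  rw [ht.stepLabel_eq_inr] at h
  constructor
  · intro h'
    by_contra hlt
    have := ht.monotone (show p ≤ c - 1 by omega)
    simp only at this
    omega
  · intro h'
    have := ht.monotone h'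
    simp only at this
    omega

theorem stepLabel_injective (ht : IsPath m ℓ t) : Function.Injective (stepLabel t) := by
  intro p q h
  cases hq : stepLabel t q with
  | inl a =>
    rw [hq] at h
    exact le_antisymm ((ht.lt_iff_of_inl h q).1 (ht.stepLabel_eq_inl.1 hq).1)
      ((ht.lt_iff_of_inl hq p).1 (ht.stepLabel_eq_inl.1 h).1)
  | inr b =>
    rw [hq] at h
    exact le_antisymm ((ht.le_iff_of_inr h q).1 (ht.stepLabel_eq_inr.1 hq).2)
      ((ht.le_iff_of_inr hq p).1 (ht.stepLabel_eq_inr.1 h).2)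

theorem exists_inl (ht : IsPath m ℓ t) (a : ℤ) : ∃ r, stepLabel t r = Sum.inl a := by
  have hm : (1 : ℤ) ≤ ((m : ℕ) : ℤ) := by exact_mod_cast m.pos
  obtain ⟨r, h1, h2⟩ := Int.exists_least_of_bdd (P := fun p => t p < a)
    ⟨0 + (-|t 0 - a|) * (((m : ℕ) : ℤ) + ((ℓ : ℕ) : ℤ)), fun p hp => by
      by_contra hlt
      have := ht.antitone (not_le.1 hlt).le
      rw [ht.shift] at this
      have := neg_abs_le (t 0 - a)
      nlinarith [abs_nonneg (t 0 - a)]⟩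
    ⟨0 + (|t 0 - a| + 1) * (((m : ℕ) : ℤ) + ((ℓ : ℕ) : ℤ)), by
      rw [ht.shift]
      have := le_abs_self (t 0 - a)
      nlinarith [abs_nonneg (t 0 - a)]⟩
  refine ⟨r, ht.stepLabel_eq_inl.2 ⟨h1, ?_⟩⟩
  by_contra h
  have := h2 (r - 1) (not_le.1 h)
  omega

theorem exists_inr (ht : IsPath m ℓ t) (b : ℤ) : ∃ c, stepLabel t c = Sum.inr b := by
  have hl : (1 : ℤ) ≤ ((ℓ : ℕ) : ℤ) := by exact_mod_cast ℓ.pos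
  obtain ⟨r, h1, h2⟩ := Int.exists_least_of_bdd (P := fun p => b ≤ p + t p)
    ⟨0 + (-(|t 0 - b| + 1)) * (((m : ℕ) : ℤ) + ((ℓ : ℕ) : ℤ)), fun p hp => by
      by_contra hlt
      have := ht.monotone (not_le.1 hlt).le
      simp only [ht.shift] at this
      have := le_abs_self (t 0 - b)
      nlinarith [abs_nonneg (t 0 - b)]⟩
    ⟨0 + |t 0 - b| * (((m : ℕ) : ℤ) + ((ℓ : ℕ) : ℤ)), by
      rw [ht.shift]
      have := neg_abs_le (t 0 - b)
      nlinarith [abs_nonneg (t 0 - b)]⟩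
  refine ⟨r, ht.stepLabel_eq_inr.2 ⟨?_, h1⟩⟩
  by_contra h
  have := h2 (r - 1) (by linarith)
  omega

theorem exists_stepLabel (ht : IsPath m ℓ t) (z : ℤ ⊕ ℤ) : ∃ p, stepLabel t p = z := by
  cases z with
  | inl a => exact ht.exists_inl a
  | inr b => exact ht.exists_inr b

theorem stepLabel_add (ht : IsPath m ℓ t) (p k : ℤ) :
    stepLabel t (p + k * (((m : ℕ) : ℤ) + ((ℓ : ℕ) : ℤ))) =
      Sum.map (· - k * ((m : ℕ) : ℤ)) (· + k * ((ℓ : ℕ) : ℤ)) (stepLabel t p) := by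
  have : p + k * (((m : ℕ) : ℤ) + ((ℓ : ℕ) : ℤ)) - 1 =
    (p - 1) + k * (((m : ℕ) : ℤ) + ((ℓ : ℕ) : ℤ)) := by ring
  unfold stepLabel
  rw [this, ht.shift, ht.shift]
  simp only [sub_lt_sub_iff_right]
  split_ifs
  · rfl
  · simp only [Sum.map_inr, Sum.inr.injEq]
    ring

end IsPath

end Profiles

/-! ### Colored hook lengths in terms of the boundary path -/

section Hooks

variable {m ℓ : ℕ+} (𝕂 : Type*) [Field 𝕂] {θ : Set (Cylinder m ℓ)} {t : ℤ → ℤ}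

theorem proj_add_right_injective (a b : ℤ) :
    Function.Injective fun k : ℕ => (proj (a, b + k) : Cylinder m ℓ) := by
  intro j k h
  have h' : (proj (a, b + j) : Cylinder m ℓ) = proj (a, b + k) := h
  rcases le_total j k with hjk | hjk
  · have := (eq_of_proj_le_proj h'.le le_rfl (by omega)).2
    omega
  · have := (eq_of_proj_le_proj h'.ge le_rfl (by omega)).2
    omega

theorem proj_add_left_injective (a b : ℤ) :
    Function.Injective fun k : ℕ => (proj (a + k, b) : Cylinder m ℓ) := by
  intro j k h
  have h' : (proj (a + j, b) : Cylinder m ℓ) = proj (a + k, b) := h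
  rcases le_total j k with hjk | hjk
  · have := (eq_of_proj_le_proj h'.le (by omega) le_rfl).1
    omega
  · have := (eq_of_proj_le_proj h'.ge (by omega) le_rfl).1
    omega

theorem cellRoot_proj (a b : ℤ) : cellRoot 𝕂 (proj (a, b) : Cylinder m ℓ) =
    simpleRoot 𝕂 ((b - a : ℤ) : ZMod (kappa m ℓ)) := rfl

/-- The contents along the arm increase from that of the cell up to the end of its row. -/
theorem cellRoot_add_arm (ht : IsProfile θ t) (hp : IsPath m ℓ t) {a b r : ℤ}
    (hab : (proj (a, b) : Cylinder m ℓ) ∈ θ) (hr : stepLabel t r = Sum.inl a) :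
    cellRoot 𝕂 (proj (a, b) : Cylinder m ℓ) + ∑ᶠ y ∈ arm θ (proj (a, b)), cellRoot 𝕂 y =
      rootSum 𝕂 r - rootSum 𝕂 (b - a) := by
  have hmem : ∀ k : ℤ, (proj (a, b + k) : Cylinder m ℓ) ∈ θ ↔ b - a + k < r := by
    intro k
    rw [ht.mem_iff, ← not_lt, hp.lt_iff_of_inl hr, not_le]
    constructor <;> intro h <;> linarith
  have h0 : b - a < r := by
    have := (hmem 0).1 (by rwa [add_zero])
    linarith
  obtain ⟨n, hn⟩ := Int.le.dest h0.le
  have harm : arm θ (proj (a, b) : Cylinder m ℓ) =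
      (fun k : ℕ => (proj (a, b + k) : Cylinder m ℓ)) '' (Finset.Ico 1 n : Finset ℕ) := by
    ext y
    simp only [arm, Set.mem_ofPred_eq, ← map_add, Prod.mk_add_mk, add_zero, Set.mem_image,
      Finset.coe_Ico, Set.mem_Ico]
    constructor
    · rintro ⟨hy, k, hk, rfl⟩
      have := (hmem k).1 hy
      exact ⟨k, ⟨hk, by omega⟩, rfl⟩
    · rintro ⟨k, ⟨hk, hk'⟩, rfl⟩
      exact ⟨(hmem k).2 (by omega), k, hk, rfl⟩
  rw [harm, finsum_mem_image (proj_add_right_injective a b).injOn, finsum_mem_coe_finset, ← hn,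
    rootSum_add_natCast, add_sub_cancel_left, Finset.range_eq_Ico,
    Finset.sum_eq_sum_Ico_succ_bot (show 0 < n by omega)]
  simp only [cellRoot_proj, Nat.cast_zero, add_zero, zero_add]
  congr 1
  refine Finset.sum_congr rfl fun k _ => ?_
  congr 2
  ring

/-- The contents along the leg decrease from that of the cell down to the end of its column. -/
theorem cellRoot_add_leg (ht : IsProfile θ t) (hp : IsPath m ℓ t) {a b c : ℤ}
    (hab : (proj (a, b) : Cylinder m ℓ) ∈ θ) (hc : stepLabel t c = Sum.inr b) :
    cellRoot 𝕂 (proj (a, b) : Cylinder m ℓ) + ∑ᶠ y ∈ leg θ (proj (a, b)), cellRoot 𝕂 y =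
      rootSum 𝕂 (b - a + 1) - rootSum 𝕂 c := by
  have hmem : ∀ k : ℤ, (proj (a + k, b) : Cylinder m ℓ) ∈ θ ↔ c + k ≤ b - a := by
    intro k
    have := hp.le_iff_of_inr hc (b - (a + k))
    rw [ht.mem_iff]
    constructor
    · intro h
      have := this.1 (by linarith)
      linarith
    · intro h
      have := this.2 (by linarith)
      linarith
  have h0 : c < b - a + 1 := by
    have := (hmem 0).1 (by rwa [add_zero])
    linarith
  obtain ⟨n, hn⟩ := Int.le.dest h0.le
  have hleg : leg θ (proj (a, b) : Cylinder m ℓ) =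
      (fun k : ℕ => (proj (a + k, b) : Cylinder m ℓ)) '' (Finset.Ico 1 n : Finset ℕ) := by
    ext y
    simp only [leg, Set.mem_ofPred_eq, ← map_add, Prod.mk_add_mk, add_zero, Set.mem_image,
      Finset.coe_Ico, Set.mem_Ico]
    constructor
    · rintro ⟨hy, k, hk, rfl⟩
      have := (hmem k).1 hy
      exact ⟨k, ⟨hk, by omega⟩, rfl⟩
    · rintro ⟨k, ⟨hk, hk'⟩, rfl⟩
      exact ⟨(hmem k).2 (by omega), k, hk, rfl⟩
  rw [hleg, finsum_mem_image (proj_add_left_injective a b).injOn, finsum_mem_coe_finset, ← hn,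
    rootSum_add_natCast, add_sub_cancel_left, ← Finset.sum_range_reflect, Finset.range_eq_Ico,
    Finset.sum_eq_sum_Ico_succ_bot (show 0 < n by omega)]
  simp only [cellRoot_proj, zero_add]
  congr 1
  · congr 2
    omega
  · refine Finset.sum_congr rfl fun k hk => ?_
    have := Finset.mem_Ico.1 hk
    congr 2
    omega

/-- A colored hook length is the difference of `rootSum` between the end of the row and the end
of the column through the cell. -/
theorem hk_proj (ht : IsProfile θ t) (hp : IsPath m ℓ t) {a b r c : ℤ}
    (hab : (proj (a, b) : Cylinder m ℓ) ∈ θ) (hr : stepLabel t r = Sum.inl a)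
    (hc : stepLabel t c = Sum.inr b) :
    hk 𝕂 θ (proj (a, b)) = rootSum 𝕂 r - rootSum 𝕂 c := by
  have h1 := cellRoot_add_arm 𝕂 ht hp hab hr
  have h2 := cellRoot_add_leg 𝕂 ht hp hab hc
  rw [rootSum_add_one, ← cellRoot_proj] at h2
  rw [hk, h1]
  rw [add_sub_right_comm, add_comm (cellRoot 𝕂 _)] at h2
  rw [add_right_cancel h2]
  abel

end Hooks

/-! ### The set `Π_θ` and the order on hooks -/

section Bottom

variable {m ℓ : ℕ+} {θ : Set (Cylinder m ℓ)} {t : ℤ → ℤ}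

theorem proj_mem_bottomSet (ht : IsProfile θ t) (u p : ℤ) :
    (proj (u, u + p) : Cylinder m ℓ) ∈ bottomSet θ ↔ u = t p := by
  change IsLeast _ _ ↔ _
  constructor
  · rintro ⟨⟨h1, -⟩, h2⟩
    have h3 : (proj (u, u + p) : Cylinder m ℓ) ≤ proj (t p, t p + p) :=
      h2 ⟨(ht _ _).2 le_rfl, by rw [content_diagonal, content_diagonal]⟩
    have h4 := (ht _ _).1 h1
    exact (eq_of_proj_le_proj h3 h4 (by linarith)).1
  · rintro rfl
    refine ⟨⟨(ht _ _).2 le_rfl, rfl⟩, ?_⟩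
    rintro x ⟨hx, hc⟩
    rw [content_diagonal] at hc
    obtain ⟨v, rfl⟩ := exists_lift_of_content hc
    have := (ht _ _).1 hx
    exact proj_le_proj this (by linarith)

/-- The maximal elements of the bottom set sit where a vertical step is followed by a horizontal
one. -/
theorem proj_mem_bottomMax (ht : IsProfile θ t) (hp : IsPath m ℓ t) (p : ℤ) :
    (proj (t p, t p + p) : Cylinder m ℓ) ∈ bottomMax θ ↔ t p < t (p - 1) ∧ t (p + 1) = t p := by
  have hb := proj_mem_bottomSet ht
  have s1 := hp.sub_one p
  have s2 := hp.succ_le p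
  have s3 := hp.le_succ p
  constructor
  · rintro ⟨-, h2⟩
    constructor
    · by_contra h
      have h3 : t (p - 1) = t p := by omega
      have h4 := h2 ((hb (t (p - 1)) (p - 1)).2 rfl) (proj_le_proj (by omega) (by omega))
      have := (eq_of_proj_le_proj h4 (by omega) (by omega)).2
      omega
    · by_contra h
      have h4 := h2 ((hb (t (p + 1)) (p + 1)).2 rfl) (proj_le_proj (by omega) (by omega))
      have := (eq_of_proj_le_proj h4 (by omega) (by omega)).1
      omega
  · rintro ⟨h1, h2⟩
    refine ⟨(hb _ _).2 rfl, ?_⟩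
    intro y hy hle
    obtain ⟨v, q, rfl, h3, h4⟩ := exists_lift_of_le hle
    rw [hb] at hy
    rcases lt_trichotomy q p with h | rfl | h
    · have := hp.antitone (show q ≤ p - 1 by omega)
      omega
    · rw [hy]
    · have := hp.monotone (show p + 1 ≤ q by omega)
      simp only at this
      omega

/-- The minimal elements of the bottom set sit where a horizontal step is followed by a vertical
one. -/
theorem proj_mem_bottomMin (ht : IsProfile θ t) (hp : IsPath m ℓ t) (p : ℤ) :
    (proj (t p, t p + p) : Cylinder m ℓ) ∈ bottomMin θ ↔ t (p - 1) = t p ∧ t (p + 1) < t p := by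
  have hb := proj_mem_bottomSet ht
  have s1 := hp.sub_one p
  have s2 := hp.succ_le p
  have s3 := hp.le_succ p
  constructor
  · rintro ⟨-, h2⟩
    constructor
    · by_contra h
      have h4 := h2 ((hb (t (p - 1)) (p - 1)).2 rfl) (proj_le_proj (by omega) (by omega))
      have := (eq_of_proj_le_proj h4 (by omega) (by omega)).1
      omega
    · by_contra h
      have h4 := h2 ((hb (t (p + 1)) (p + 1)).2 rfl) (proj_le_proj (by omega) (by omega))
      have := (eq_of_proj_le_proj h4 (by omega) (by omega)).2
      omega
  · rintro ⟨h1, h2⟩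
    refine ⟨(hb _ _).2 rfl, ?_⟩
    intro y hy hle
    obtain ⟨v, q, rfl, h3, h4⟩ := exists_lift_of_ge hle
    rw [hb] at hy
    rcases lt_trichotomy q p with h | rfl | h
    · have := hp.monotone (show q ≤ p - 1 by omega)
      simp only at this
      omega
    · rw [hy]
    · have := hp.antitone (show p + 1 ≤ q by omega)
      omega

theorem exists_of_mem_bottomSet (ht : IsProfile θ t) {x : Cylinder m ℓ}
    (hx : x ∈ bottomSet θ) : ∃ p, x = proj (t p, t p + p) := by
  obtain ⟨u, p, rfl⟩ := exists_diagonal_lift x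
  rw [proj_mem_bottomSet ht] at hx
  exact ⟨p, by rw [hx]⟩

variable (𝕂 : Type*) [Field 𝕂]

theorem rootSum_row_mem_cylindricSimple (ht : IsProfile θ t) (hp : IsPath m ℓ t) {a r r' : ℤ}
    (hr : stepLabel t r = Sum.inl a) (hr' : stepLabel t r' = Sum.inl (a + 1)) :
    rootSum 𝕂 r - rootSum 𝕂 r' ∈ cylindricSimple 𝕂 θ := by
  have s1 := hp.sub_one r'
  have s2 := hp.succ_le r'
  have s3 := hp.le_succ r'
  have h1 := hp.stepLabel_eq_inl.1 hr'
  obtain rfl : a = t r' := by omega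
  by_cases h2 : t (r' + 1) = t r'
  · refine Or.inl (Or.inr ⟨_, (proj_mem_bottomMax ht hp r').2 ⟨by omega, h2⟩, ?_⟩)
    have := cellRoot_add_arm 𝕂 ht hp ((ht _ _).2 le_rfl) hr
    rwa [add_sub_cancel_left] at this
  · have h3 : r = r' + 1 := by
      have h4 := hp.lt_iff_of_inl hr
      have h5 := (h4 (r' + 1)).1 (by omega)
      have h6 := mt (h4 r').2 (lt_irrefl _)
      omega
    refine Or.inl (Or.inl ⟨proj (t r', t r' + r'), ⟨(proj_mem_bottomSet ht _ _).2 rfl, ?_⟩, ?_⟩)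
    · rintro (h | h)
      · rw [proj_mem_bottomMax ht hp] at h
        omega
      · rw [proj_mem_bottomMin ht hp] at h
        omega
    · rw [cellRoot_proj, add_sub_cancel_left, simpleRoot_eq_rootSum_sub, h3]

theorem rootSum_column_mem_cylindricSimple (ht : IsProfile θ t) (hp : IsPath m ℓ t) {b c c' : ℤ}
    (hc : stepLabel t c = Sum.inr b) (hc' : stepLabel t c' = Sum.inr (b + 1)) :
    rootSum 𝕂 c' - rootSum 𝕂 c ∈ cylindricSimple 𝕂 θ := by
  have s1 := hp.sub_one (c' - 1)
  have s4 := hp.sub_one c'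
  have h0 := hp.stepLabel_eq_inr.1 hc'
  have h1 : t c' = t (c' - 1) := by omega
  obtain rfl : b = t (c' - 1) + (c' - 1) := by omega
  by_cases h2 : t (c' - 1) < t (c' - 1 - 1)
  · refine Or.inr ⟨_, (proj_mem_bottomMax ht hp (c' - 1)).2 ⟨h2, by rwa [sub_add_cancel]⟩, ?_⟩
    have := cellRoot_add_leg 𝕂 ht hp ((ht _ _).2 le_rfl) hc
    rwa [add_sub_cancel_left, sub_add_cancel] at this
  · have h3 : c = c' - 1 := by
      have h4 := hp.le_iff_of_inr hc
      have h5 := (h4 (c' - 1)).1 (by omega)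
      have h6 := mt (h4 (c' - 1 - 1)).2 (by omega)
      omega
    refine Or.inl (Or.inl ⟨proj (t (c' - 1), t (c' - 1) + (c' - 1)),
      ⟨(proj_mem_bottomSet ht _ _).2 rfl, ?_⟩, ?_⟩)
    · rintro (h | h)
      · rw [proj_mem_bottomMax ht hp] at h
        omega
      · rw [proj_mem_bottomMin ht hp, sub_add_cancel] at h
        omega
    · rw [cellRoot_proj, add_sub_cancel_left, simpleRoot_eq_rootSum_sub, h3, sub_add_cancel]

/-- The elements of `Π_θ` are the differences of `rootSum` between the ends of neighbouring rows,
and those between the ends of neighbouring columns. -/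
theorem mem_cylindricSimple_iff (ht : IsProfile θ t) (hp : IsPath m ℓ t)
    {β : CartanDual 𝕂 (kappa m ℓ)} : β ∈ cylindricSimple 𝕂 θ ↔
      (∃ a r r' : ℤ, stepLabel t r = Sum.inl a ∧ stepLabel t r' = Sum.inl (a + 1) ∧
        β = rootSum 𝕂 r - rootSum 𝕂 r') ∨
      ∃ b c c' : ℤ, stepLabel t c = Sum.inr b ∧ stepLabel t c' = Sum.inr (b + 1) ∧
        β = rootSum 𝕂 c' - rootSum 𝕂 c := by
  constructor
  · rintro ((⟨x, ⟨h1, h2⟩, rfl⟩ | ⟨x, h1, rfl⟩) | ⟨x, h1, rfl⟩)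
    · obtain ⟨p, rfl⟩ := exists_of_mem_bottomSet ht h1
      have h3 := mt Or.inl h2
      have h4 := mt Or.inr h2
      rw [proj_mem_bottomMax ht hp] at h3
      rw [proj_mem_bottomMin ht hp] at h4
      have s1 := hp.sub_one p
      have s2 := hp.succ_le p
      have s3 := hp.le_succ p
      rw [cellRoot_proj, add_sub_cancel_left, simpleRoot_eq_rootSum_sub]
      by_cases h5 : t p < t (p - 1)
      · refine Or.inl ⟨t p, p + 1, p, ?_, ?_, rfl⟩
        · rw [hp.stepLabel_eq_inl, add_sub_cancel_right]
          omega
        · rw [hp.stepLabel_eq_inl]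
          omega
      · refine Or.inr ⟨p + t p, p, p + 1, ?_, ?_, rfl⟩
        · rw [hp.stepLabel_eq_inr]
          omega
        · rw [hp.stepLabel_eq_inr, add_sub_cancel_right]
          omega
    · obtain ⟨p, rfl⟩ := exists_of_mem_bottomSet ht h1.1
      rw [proj_mem_bottomMax ht hp] at h1
      obtain ⟨r, hr⟩ := hp.exists_inl (t p)
      have s1 := hp.sub_one p
      refine Or.inl ⟨t p, r, p, hr, ?_, ?_⟩
      · rw [hp.stepLabel_eq_inl]
        omega
      · have := cellRoot_add_arm 𝕂 ht hp ((ht _ _).2 le_rfl) hr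
        rwa [add_sub_cancel_left] at this
    · obtain ⟨p, rfl⟩ := exists_of_mem_bottomSet ht h1.1
      rw [proj_mem_bottomMax ht hp] at h1
      obtain ⟨c, hc⟩ := hp.exists_inr (t p + p)
      refine Or.inr ⟨t p + p, c, p + 1, hc, ?_, ?_⟩
      · rw [hp.stepLabel_eq_inr, add_sub_cancel_right]
        omega
      · have := cellRoot_add_leg 𝕂 ht hp ((ht _ _).2 le_rfl) hc
        rwa [add_sub_cancel_left] at this
  · rintro (⟨a, r, r', h1, h2, rfl⟩ | ⟨b, c, c', h1, h2, rfl⟩)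
    · exact rootSum_row_mem_cylindricSimple 𝕂 ht hp h1 h2
    · exact rootSum_column_mem_cylindricSimple 𝕂 ht hp h1 h2

theorem rootSum_row_mem_closure (ht : IsProfile θ t) (hp : IsPath m ℓ t) {a r r' : ℤ} (n : ℕ)
    (hr : stepLabel t r = Sum.inl a) (hr' : stepLabel t r' = Sum.inl (a + n)) :
    rootSum 𝕂 r - rootSum 𝕂 r' ∈ AddSubmonoid.closure (cylindricSimple 𝕂 θ) := by
  induction n generalizing r' with
  | zero =>
    rw [Nat.cast_zero, add_zero] at hr'
    rw [hp.stepLabel_injective (hr.trans hr'.symm), sub_self]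
    exact zero_mem _
  | succ n ih =>
    obtain ⟨q, hq⟩ := hp.exists_inl (a + n)
    rw [Nat.cast_succ, ← add_assoc] at hr'
    rw [← sub_add_sub_cancel _ (rootSum 𝕂 q)]
    exact add_mem (ih hq)
      (AddSubmonoid.subset_closure (rootSum_row_mem_cylindricSimple 𝕂 ht hp hq hr'))

theorem rootSum_column_mem_closure (ht : IsProfile θ t) (hp : IsPath m ℓ t) {b c c' : ℤ} (n : ℕ)
    (hc : stepLabel t c = Sum.inr b) (hc' : stepLabel t c' = Sum.inr (b + n)) :
    rootSum 𝕂 c' - rootSum 𝕂 c ∈ AddSubmonoid.closure (cylindricSimple 𝕂 θ) := by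
  induction n generalizing c' with
  | zero =>
    rw [Nat.cast_zero, add_zero] at hc'
    rw [hp.stepLabel_injective (hc.trans hc'.symm), sub_self]
    exact zero_mem _
  | succ n ih =>
    obtain ⟨q, hq⟩ := hp.exists_inr (b + n)
    rw [Nat.cast_succ, ← add_assoc] at hc'
    rw [← sub_add_sub_cancel _ (rootSum 𝕂 q)]
    exact add_mem
      (AddSubmonoid.subset_closure (rootSum_column_mem_cylindricSimple 𝕂 ht hp hq hc')) (ih hq)

/-- A function on `ℤ` that grows by `1` with every period `κ` is induced by a linear form
on `𝔥^*`. -/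
theorem exists_form_rootSum [CharZero 𝕂] {g : ℤ → ℤ}
    (hg : ∀ p k : ℤ, g (p + k * (((m : ℕ) : ℤ) + ((ℓ : ℕ) : ℤ))) = g p + k) :
    ∃ f : CartanDual 𝕂 (kappa m ℓ) →ₗ[𝕂] 𝕂,
      ∀ p q : ℤ, f (rootSum 𝕂 q - rootSum 𝕂 p) = ((g q - g p : ℤ) : 𝕂) := by
  have hlift : ∀ i : ZMod (kappa m ℓ), ∃ d : ℤ,
      ∀ p : ℤ, (p : ZMod (kappa m ℓ)) = i → g (p + 1) - g p = d := by
    intro i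
    obtain ⟨q, rfl⟩ := ZMod.intCast_surjective i
    refine ⟨g (q + 1) - g q, fun p hpq => ?_⟩
    obtain ⟨k, rfl⟩ := intCast_eq_iff_exists.1 hpq
    have := hg (q + 1) k
    rw [add_right_comm, this, hg]
    ring
  choose d hd using hlift
  obtain ⟨f, hf⟩ := exists_form_simpleRoot 𝕂 (two_le_kappa m ℓ) (fun i => ((d i : ℤ) : 𝕂))
  exact ⟨f, form_rootSum_sub 𝕂 fun p => by rw [hf, hd _ p rfl]⟩

variable {𝕂}

/-- The hook map is an order embedding of a cylindric diagram. For the direction from roots to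
cells, a linear form is used that is nonnegative on `Π_θ`, where it only sees one row in each
residue class mod `m` and one column in each residue class mod `ℓ`. -/
theorem le_iff_cylLE_hk [CharZero 𝕂] (ht : IsProfile θ t) (hp : IsPath m ℓ t)
    {x y : Cylinder m ℓ} (hx : x ∈ θ) (hy : y ∈ θ) :
    x ≤ y ↔ cylLE θ (hk 𝕂 θ x) (hk 𝕂 θ y) := by
  have hm : (0 : ℤ) < ((m : ℕ) : ℤ) := by exact_mod_cast m.pos
  have hl : (0 : ℤ) < ((ℓ : ℕ) : ℤ) := by exact_mod_cast ℓ.pos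
  have key : ∀ r r' c c' : ℤ, (rootSum 𝕂 r' - rootSum 𝕂 c' - (rootSum 𝕂 r - rootSum 𝕂 c) :
      CartanDual 𝕂 (kappa m ℓ)) = (rootSum 𝕂 r' - rootSum 𝕂 r) + (rootSum 𝕂 c - rootSum 𝕂 c') :=
    fun r r' c c' => by abel
  constructor
  · rintro ⟨⟨a, b⟩, ⟨a', b'⟩, rfl, rfl, h1, h2⟩
    obtain ⟨j, hj⟩ := Int.le.dest (show a' ≤ a from h1)
    obtain ⟨k, hk'⟩ := Int.le.dest (show b' ≤ b from h2)
    obtain ⟨r, hr⟩ := hp.exists_inl a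
    obtain ⟨r', hr'⟩ := hp.exists_inl a'
    obtain ⟨c, hc⟩ := hp.exists_inr b
    obtain ⟨c', hc'⟩ := hp.exists_inr b'
    rw [cylLE, hk_proj 𝕂 ht hp hx hr hc, hk_proj 𝕂 ht hp hy hr' hc', key]
    rw [← hj] at hr
    rw [← hk'] at hc
    exact add_mem (rootSum_row_mem_closure 𝕂 ht hp j hr' hr)
      (rootSum_column_mem_closure 𝕂 ht hp k hc' hc)
  · obtain ⟨a, b, rfl⟩ := exists_lift x
    obtain ⟨a', b', rfl⟩ := exists_lift y
    obtain ⟨r, hr⟩ := hp.exists_inl a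
    obtain ⟨r', hr'⟩ := hp.exists_inl a'
    obtain ⟨c, hc⟩ := hp.exists_inr b
    obtain ⟨c', hc'⟩ := hp.exists_inr b'
    rw [cylLE, hk_proj 𝕂 ht hp hx hr hc, hk_proj 𝕂 ht hp hy hr' hc', key]
    intro h
    -- `φ` drops by `1` between the rows `j` and `j + 1` if `j ≡ a` mod `m`, and otherwise not at
    -- all; it grows by `1` between the columns `j` and `j + 1` if `j + 1 ≡ b'` mod `ℓ`. On the
    -- difference of the two hooks its value is `⌊(a - a') / m⌋ + ⌊(b - b') / ℓ⌋`.
    let φ : ℤ ⊕ ℤ → ℤ :=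
      Sum.elim (fun j => (a - j) / ((m : ℕ) : ℤ)) (fun j => (j - b') / ((ℓ : ℕ) : ℤ))
    obtain ⟨f, hf⟩ := exists_form_rootSum 𝕂 (m := m) (ℓ := ℓ) (g := fun p => φ (stepLabel t p))
      (fun p k => by
        rw [hp.stepLabel_add]
        cases stepLabel t p with
        | inl j =>
          simp only [φ, Sum.map_inl, Sum.elim_inl]
          rw [← Int.add_mul_ediv_right _ _ hm.ne']
          congr 1
          ring
        | inr j =>
          simp only [φ, Sum.map_inr, Sum.elim_inr]
          rw [← Int.add_mul_ediv_right _ _ hl.ne']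
          congr 1
          ring)
    have hnat : ∀ β ∈ AddSubmonoid.closure (cylindricSimple 𝕂 θ), ∃ n : ℕ, f β = n := by
      intro β hβ
      induction hβ using AddSubmonoid.closure_induction with
      | mem β hβ =>
        have hz : ∀ z : ℤ, 0 ≤ z → ∃ n : ℕ, (z : 𝕂) = n := by
          intro z hz
          obtain ⟨n, rfl⟩ := Int.eq_ofNat_of_zero_le hz
          exact ⟨n, by simp⟩
        rw [mem_cylindricSimple_iff 𝕂 ht hp] at hβ
        rcases hβ with ⟨j, r, r', h1, h2, rfl⟩ | ⟨j, r, r', h1, h2, rfl⟩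
        · rw [hf]
          simp only [h1, h2]
          exact hz _ (sub_nonneg.2 (Int.ediv_le_ediv hm (by linarith)))
        · rw [hf]
          simp only [h1, h2]
          exact hz _ (sub_nonneg.2 (Int.ediv_le_ediv hl (by linarith)))
      | zero => exact ⟨0, by simp⟩
      | add x y _ _ hx hy =>
        obtain ⟨a, ha⟩ := hx
        obtain ⟨b, hb⟩ := hy
        exact ⟨a + b, by simp [ha, hb]⟩
    obtain ⟨n, hn⟩ := hnat _ h
    rw [map_add, hf, hf, ← Int.cast_add] at hn
    simp only [hr, hr', hc, hc', φ, Sum.elim_inl, Sum.elim_inr, sub_self, Int.zero_ediv] at hn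
    have hn' : (a - a') / ((m : ℕ) : ℤ) - 0 + ((b - b') / ((ℓ : ℕ) : ℤ) - 0) = n := by
      exact_mod_cast hn
    have h1 := Int.ediv_mul_le (a - a') hm.ne'
    have h2 := Int.ediv_mul_le (b - b') hl.ne'
    refine proj_le_proj_iff.2 ⟨-((a - a') / ((m : ℕ) : ℤ)), by linarith, ?_⟩
    have h3 : -((a - a') / ((m : ℕ) : ℤ)) ≤ (b - b') / ((ℓ : ℕ) : ℤ) := by linarith
    have h4 := mul_le_mul_of_nonneg_right h3 hl.le
    linarith

end Bottom

/-! ### Removing a minimal cell -/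

section Removal

variable {m ℓ : ℕ+} {θ : Set (Cylinder m ℓ)} {t : ℤ → ℤ}

/-- A minimal cell of a diagram fills a corner of the boundary path. -/
theorem exists_of_minimal (ht : IsProfile θ t) (hp : IsPath m ℓ t) {x : Cylinder m ℓ}
    (hx : Minimal (· ∈ θ) x) : ∃ p : ℤ, x = proj (t p, t p + p) ∧ t (p - 1) = t p ∧
      t (p + 1) = t p - 1 := by
  obtain ⟨u, p, rfl⟩ := exists_diagonal_lift x
  have s1 := hp.sub_one p
  have s2 := hp.succ_le p
  have s3 := hp.le_succ p
  have h0 := (ht _ _).1 hx.1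
  have h1 : ¬ u + 1 ≤ t (p - 1) := fun h => by
    have h2 := hx.2 ((ht _ _).2 h) (proj_le_proj (by omega) (by omega))
    have := (eq_of_proj_le_proj h2 (by omega) (by omega)).1
    omega
  have h2 : ¬ u ≤ t (p + 1) := fun h => by
    have h2 := hx.2 ((ht _ _).2 h) (proj_le_proj (by omega) (by omega))
    have := (eq_of_proj_le_proj h2 (by omega) (by omega)).2
    omega
  obtain rfl : u = t p := by omega
  exact ⟨p, rfl, by omega, by omega⟩

/-- The path obtained from `t` by removing the cell at the corner between the steps at `p` and
`p + 1`. -/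
def removeCorner (κ : ℕ) (t : ℤ → ℤ) (p q : ℤ) : ℤ :=
  if (q : ZMod κ) = p then t q - 1 else t q

theorem isProfile_removeCorner (ht : IsProfile θ t) (hp : IsPath m ℓ t) (p : ℤ) :
    IsProfile (θ \ {proj (t p, t p + p)}) (removeCorner (kappa m ℓ) t p) := by
  intro v q
  rw [Set.mem_sdiff, Set.mem_singleton_iff, ht, removeCorner]
  split_ifs with h
  · obtain ⟨k, rfl⟩ := intCast_eq_iff_exists.1 h
    have : (proj (t p, t p + p) : Cylinder m ℓ) =
        proj (t p - k * ((m : ℕ) : ℤ), t p - k * ((m : ℕ) : ℤ) +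
          (p + k * (((m : ℕ) : ℤ) + ((ℓ : ℕ) : ℤ)))) := by
      rw [← proj_add_mul (t p) _ (-k)]
      congr 1
      ext
      · simp only
        ring
      · simp only
        ring
    rw [this, hp.shift]
    constructor
    · rintro ⟨h1, h2⟩
      by_contra h3
      exact h2 (by rw [show v = t p - k * ((m : ℕ) : ℤ) by omega])
    · intro h1
      refine ⟨by omega, fun h2 => ?_⟩
      have := (eq_of_proj_le_proj h2.le (by omega) (by omega)).1
      omega
  · refine ⟨And.left, fun h1 => ⟨h1, fun h2 => h ?_⟩⟩
    have := congrArg content h2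
    rwa [content_diagonal, content_diagonal] at this

/-- Removing a corner exchanges the two adjacent steps. -/
theorem stepLabel_removeCorner (hp : IsPath m ℓ t) {p : ℤ} (h1 : t (p - 1) = t p)
    (h2 : t (p + 1) = t p - 1) (q : ℤ) :
    stepLabel (removeCorner (kappa m ℓ) t p) q =
      stepLabel t (affineSwap (p : ZMod (kappa m ℓ)) q) := by
  have hne : (1 : ZMod (kappa m ℓ)) ≠ 0 := one_ne_zero_of_two_le (two_le_kappa m ℓ)
  have e1 : ∀ q : ℤ, (q : ZMod (kappa m ℓ)) = p → t (q - 1) = t q ∧ t (q + 1) = t q - 1 := by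
    intro q hq
    obtain ⟨k, rfl⟩ := intCast_eq_iff_exists.1 hq
    rw [add_sub_right_comm, add_right_comm, hp.shift, hp.shift, hp.shift, h1, h2]
    constructor <;> ring
  by_cases hq : (q : ZMod (kappa m ℓ)) = p
  · have hq' : ((q - 1 : ℤ) : ZMod (kappa m ℓ)) ≠ p := by
      push_cast
      exact fun h => hne (by linear_combination hq - h)
    obtain ⟨e2, e3⟩ := e1 q hq
    simp only [stepLabel, removeCorner, affineSwap, hq, hq', if_true, if_false,
      add_sub_cancel_right]
    rw [if_pos (by omega), if_pos (by omega), e2]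
  · by_cases hq' : (q : ZMod (kappa m ℓ)) = p + 1
    · have hq2 : ((q - 1 : ℤ) : ZMod (kappa m ℓ)) = p := by
        push_cast
        linear_combination hq'
      obtain ⟨e2, e3⟩ := e1 _ hq2
      rw [sub_add_cancel] at e3
      simp only [stepLabel, removeCorner, affineSwap, hq, hq2, if_true, if_false]
      rw [if_neg (by omega), if_pos hq', if_neg (by omega)]
      congr 1
      omega
    · have hq2 : ((q - 1 : ℤ) : ZMod (kappa m ℓ)) ≠ p := by
        push_cast
        exact fun h => hq' (by linear_combination h)
      simp only [stepLabel, removeCorner, affineSwap, hq, hq2, hq', if_false]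

end Removal

/-! ### Linear extensions and their Weyl group elements -/

section Fillings

variable {m ℓ : ℕ+}

/-- The list `L` enumerates its cells in an order that refines the order of the cylinder. -/
def IsLinearExtension (L : List (Cylinder m ℓ)) : Prop := L.Pairwise fun x y => ¬ y ≤ x

theorem IsLinearExtension.nodup {L : List (Cylinder m ℓ)} (hL : IsLinearExtension L) : L.Nodup :=
  List.Pairwise.imp (fun h => fun e => h e.ge) hL

theorem isLinearExtension_concat {L : List (Cylinder m ℓ)} {x : Cylinder m ℓ} :
    IsLinearExtension (L ++ [x]) ↔ IsLinearExtension L ∧ ∀ y ∈ L, ¬ x ≤ y := by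
  simp [IsLinearExtension, List.pairwise_append]

theorem exists_isLinearExtension (η : Set (Cylinder m ℓ)) (hη : η.Finite) :
    ∃ L : List (Cylinder m ℓ), IsLinearExtension L ∧ {x | x ∈ L} = η := by
  induction h : η.ncard generalizing η with
  | zero =>
    rw [Set.ncard_eq_zero hη] at h
    exact ⟨[], List.Pairwise.nil, by simp [h]⟩
  | succ n ih =>
    have hne : η.Nonempty := by
      rw [← Set.ncard_pos hη]
      omega
    obtain ⟨x, hx⟩ := hη.exists_maximal hne
    obtain ⟨L, h1, h2⟩ := ih (η \ {x}) (hη.subset Set.sdiff_subset) (by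
      rw [Set.ncard_sdiff_singleton_of_mem hx.1, h]
      rfl)
    refine ⟨L ++ [x], isLinearExtension_concat.2 ⟨h1, fun y hy hxy => ?_⟩, ?_⟩
    · have hy' : y ∈ η \ {x} := h2 ▸ hy
      exact hy'.2 (le_antisymm (hx.2 hy'.1 hxy) hxy)
    · have e : {y | y ∈ L ++ [x]} = {y | y ∈ L} ∪ {x} := by
        ext y
        simp [or_comm]
      rw [e, h2, Set.sdiff_union_self, Set.union_eq_self_of_subset_right]
      exact Set.singleton_subset_iff.2 hx.1

variable {θ : Set (Cylinder m ℓ)}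

theorem IsCylindricDiagram.sdiff (hθ : IsCylindricDiagram θ) {η : Set (Cylinder m ℓ)}
    (hη : η ∈ properOrderIdeals θ) : IsCylindricDiagram (θ \ η) := by
  obtain ⟨⟨h1, h2⟩, h3⟩ := hη
  refine ⟨?_, ?_, ?_⟩
  · rintro x y hxy ⟨hx, hx'⟩
    exact ⟨hθ.1 hxy hx, fun hy => hx' (h2 y hy x hx hxy)⟩
  · rw [Ne, Set.sdiff_eq_empty]
    exact fun h => h3 (h1.antisymm h)
  · intro h
    exact hθ.2.2 (Set.univ_subset_iff.1 (h ▸ Set.sdiff_subset))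

/-- The last cell of an enumeration of an order ideal is minimal in the complement of the ideal
formed by the others. -/
theorem IsLinearExtension.concat_ideal {L : List (Cylinder m ℓ)} {x : Cylinder m ℓ}
    (hL : IsLinearExtension (L ++ [x])) (hI : {y | y ∈ L ++ [x]} ∈ properOrderIdeals θ) :
    IsLinearExtension L ∧ {y | y ∈ L} ∈ properOrderIdeals θ ∧
      Minimal (· ∈ θ \ {y | y ∈ L}) x := by
  obtain ⟨h1, h2⟩ := isLinearExtension_concat.1 hL
  obtain ⟨⟨h3, h4⟩, h5⟩ := hI
  have hxL : x ∉ L := fun h => h2 x h le_rfl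
  have hxθ : x ∈ θ := h3 (by simp)
  have hsub : ∀ y ∈ L, y ∈ L ++ [x] := fun y hy => List.mem_append_left _ hy
  refine ⟨h1, ⟨⟨fun y hy => h3 (hsub y hy), fun y hy z hz hzy => ?_⟩, ?_⟩, ⟨hxθ, hxL⟩, ?_⟩
  · have := h4 y (hsub y hy) z hz hzy
    rcases List.mem_append.1 this with h | h
    · exact h
    · rw [List.mem_singleton.1 h] at hzy
      exact absurd hzy (h2 y hy)
  · intro h
    exact hxL (h.symm ▸ hxθ : x ∈ {y | y ∈ L})
  · rintro z ⟨hz, hz'⟩ hzx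
    have := h4 x (by simp) z hz hzx
    rcases List.mem_append.1 this with h | h
    · exact absurd h hz'
    · exact (List.mem_singleton.1 h).ge

/-- Cells with equal or neighbouring contents are comparable. -/
theorem le_or_le_of_content {x y : Cylinder m ℓ}
    (h : content y = content x ∨ content y = content x + 1) : x ≤ y ∨ y ≤ x := by
  obtain ⟨u, p, rfl⟩ := exists_diagonal_lift x
  rw [content_diagonal] at h
  rcases h with h | h
  · obtain ⟨v, rfl⟩ := exists_lift_of_content h
    rcases le_total u v with h1 | h1
    · exact Or.inr (proj_le_proj h1 (by omega))
    · exact Or.inl (proj_le_proj h1 (by omega))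
  · obtain ⟨v, rfl⟩ := exists_lift_of_content (p := p + 1) (by rw [h]; push_cast; rfl)
    rcases lt_or_ge v u with h1 | h1
    · exact Or.inl (proj_le_proj h1.le (by omega))
    · exact Or.inr (proj_le_proj h1 (by omega))

variable (𝕂 : Type*) [Field 𝕂]

/-- The product of the reflections attached to a list of cells. -/
def listElement (L : List (Cylinder m ℓ)) : weylGroup 𝕂 (kappa m ℓ) :=
  (L.map (cellReflection 𝕂)).prod

theorem listElement_concat (L : List (Cylinder m ℓ)) (x : Cylinder m ℓ) :
    listElement 𝕂 (L ++ [x]) = listElement 𝕂 L * s 𝕂 (content x) := by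
  simp [listElement, cellReflection]

theorem cellReflection_mul_comm {x y : Cylinder m ℓ} (h1 : ¬ x ≤ y) (h2 : ¬ y ≤ x) :
    s 𝕂 (content x) * s 𝕂 (content y) = s 𝕂 (content y) * s 𝕂 (content x) := by
  refine s_mul_comm_of_cartanEntry (two_le_kappa m ℓ) (fun h => ?_) (fun h => ?_)
  · have := le_or_le_of_content (x := y) (y := x) (Or.inr (by rw [h, sub_add_cancel]))
    tauto
  · have := le_or_le_of_content (x := x) (y := y) (Or.inr h)
    tauto

/-- The product of the reflections does not depend on the enumeration: two enumerations that end
in different cells `x` and `y` are both compared with enumerations ending in `x, y` and `y, x`. -/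
theorem listElement_eq {L L' : List (Cylinder m ℓ)} (hL : IsLinearExtension L)
    (hL' : IsLinearExtension L') (h : {x | x ∈ L} = {x | x ∈ L'}) :
    listElement 𝕂 L = listElement 𝕂 L' := by
  induction hn : L.length using Nat.strong_induction_on generalizing L L' with
  | _ n ih =>
  induction L using List.reverseRecOn with
  | nil =>
    have : L' = [] := List.eq_nil_iff_forall_not_mem.2 fun x hx => by
      have : x ∈ {x | x ∈ ([] : List (Cylinder m ℓ))} := h ▸ hx
      simp at this
    rw [this]
  | append_singleton M x _ =>
    induction L' using List.reverseRecOn with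
    | nil =>
      have : x ∈ {x | x ∈ ([] : List (Cylinder m ℓ))} := h ▸ (by simp)
      simp at this
    | append_singleton M' x' _ =>
      obtain ⟨h1, h2⟩ := isLinearExtension_concat.1 hL
      obtain ⟨h1', h2'⟩ := isLinearExtension_concat.1 hL'
      rw [List.length_append, List.length_singleton] at hn
      have hmem : ∀ y, (y ∈ M ∨ y = x) ↔ (y ∈ M' ∨ y = x') := fun y => by
        have := Set.ext_iff.1 h y
        simpa using this
      have hlen : M'.length = M.length := by
        have h3 : (M' ++ [x']).Perm (M ++ [x]) :=
          (List.perm_ext_iff_of_nodup hL'.nodup hL.nodup).2 fun y => (Set.ext_iff.1 h y).symm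
        have := h3.length_eq
        simpa using this
      have hxM : x ∉ M := fun h' => h2 x h' le_rfl
      have hxM' : x' ∉ M' := fun h' => h2' x' h' le_rfl
      rw [listElement_concat, listElement_concat]
      by_cases hx : x = x'
      · subst hx
        rw [ih M.length (by omega) h1 h1' ?_ rfl]
        ext y
        have := hmem y
        by_cases hy : y = x
        · subst hy
          simp [hxM, hxM']
        · simpa [hy] using this
      · obtain ⟨N, hN, hN'⟩ := exists_isLinearExtension ({y | y ∈ M} \ {x'})
          (M.finite_toSet.subset Set.sdiff_subset)
        have hNmem : ∀ y, y ∈ N ↔ y ∈ M ∧ y ≠ x' := fun y => Set.ext_iff.1 hN' y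
        have hx'M : x' ∈ M := ((hmem x').2 (Or.inr rfl)).resolve_right (Ne.symm hx)
        have hxM'2 : x ∈ M' := ((hmem x).1 (Or.inr rfl)).resolve_right hx
        have hNM' : ∀ y ∈ N, y ∈ M' := fun y hy =>
          ((hmem y).1 (Or.inl ((hNmem y).1 hy).1)).resolve_right ((hNmem y).1 hy).2
        have e1 : listElement 𝕂 M = listElement 𝕂 (N ++ [x']) := by
          refine ih M.length (by omega) h1
            (isLinearExtension_concat.2 ⟨hN, fun y hy => h2' y (hNM' y hy)⟩) ?_ rfl
          ext y
          simp only [Set.mem_ofPred_eq, List.mem_append, List.mem_singleton, hNmem]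
          by_cases hy : y = x'
          · simp [hy, hx'M]
          · simp [hy]
        have e2 : listElement 𝕂 M' = listElement 𝕂 (N ++ [x]) := by
          refine ih M'.length (by omega) h1'
            (isLinearExtension_concat.2 ⟨hN, fun y hy => h2 y ((hNmem y).1 hy).1⟩) ?_ rfl
          ext y
          simp only [Set.mem_ofPred_eq, List.mem_append, List.mem_singleton, hNmem]
          have := hmem y
          by_cases hy : y = x'
          · subst hy
            simp [hxM', Ne.symm hx]
          · simp only [hy, or_false, ne_eq, not_false_eq_true, and_true] at this ⊢
            exact this.symm
        rw [e1, e2, listElement_concat, listElement_concat, mul_assoc, mul_assoc,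
          cellReflection_mul_comm 𝕂 (h2 x' hx'M) (h2' x hxM'2)]

variable {t : ℤ → ℤ}

/-- If `L` enumerates an order ideal of `θ`, its Weyl group element carries the boundary of the
complement of the ideal to the boundary of `θ`, step by step. -/
theorem listElement_rootSum_sub (hθ : IsCylindricDiagram θ) (ht : IsProfile θ t)
    {L : List (Cylinder m ℓ)} (hL : IsLinearExtension L)
    (hI : {x | x ∈ L} ∈ properOrderIdeals θ) {t' : ℤ → ℤ} (ht' : IsProfile (θ \ {x | x ∈ L}) t')
    {p q p' q' : ℤ} (hpp : stepLabel t' p' = stepLabel t p)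
    (hqq : stepLabel t' q' = stepLabel t q) :
    (listElement 𝕂 L).1 (rootSum 𝕂 p' - rootSum 𝕂 q') = rootSum 𝕂 p - rootSum 𝕂 q := by
  induction L using List.reverseRecOn generalizing t' p' q' with
  | nil =>
    have e : θ \ {x | x ∈ ([] : List (Cylinder m ℓ))} = θ := by
      ext
      simp
    rw [e] at ht'
    obtain rfl := ht'.unique ht
    have hp := ht.isPath hθ.1
    rw [hp.stepLabel_injective hpp, hp.stepLabel_injective hqq]
    rfl
  | append_singleton L x ih =>
    obtain ⟨h1, h2, h3⟩ := hL.concat_ideal hI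
    obtain ⟨τ, hτ, hp⟩ := (hθ.sdiff h2).exists_profile
    obtain ⟨r, hx, e1, e2⟩ := exists_of_minimal hτ hp h3
    have hτ' := isProfile_removeCorner hτ hp r
    have e : θ \ {y | y ∈ L ++ [x]} = (θ \ {y | y ∈ L}) \ {x} := by
      ext y
      simp only [Set.mem_sdiff, Set.mem_ofPred_eq, List.mem_append, List.mem_singleton,
        Set.mem_singleton_iff]
      tauto
    rw [← hx, ← e] at hτ'
    obtain rfl := ht'.unique hτ'
    rw [stepLabel_removeCorner hp e1 e2] at hpp hqq
    rw [listElement_concat, coe_mul_apply, s_apply, hx, content_diagonal,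
      simpleReflectionGL_rootSum_sub 𝕂 (two_le_kappa m ℓ)]
    exact ih h1 h2 hτ hpp hqq

/-- The root by which the inversion set grows when the cell `x` is added is the hook of `x`. -/
theorem listElement_cellRoot (hθ : IsCylindricDiagram θ) {L : List (Cylinder m ℓ)}
    (hL : IsLinearExtension L) (hI : {x | x ∈ L} ∈ properOrderIdeals θ) {x : Cylinder m ℓ}
    (hx : Minimal (· ∈ θ \ {x | x ∈ L}) x) :
    (listElement 𝕂 L).1 (simpleRoot 𝕂 (content x)) = hk 𝕂 θ x := by
  obtain ⟨t, ht, hp⟩ := hθ.exists_profile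
  obtain ⟨t', ht', hp'⟩ := (hθ.sdiff hI).exists_profile
  have hxθ := hx.1.1
  obtain ⟨p, rfl, h1, h2⟩ := exists_of_minimal ht' hp' hx
  obtain ⟨r, hr⟩ := hp.exists_inl (t' p)
  obtain ⟨c, hc⟩ := hp.exists_inr (t' p + p)
  rw [content_diagonal, simpleRoot_eq_rootSum_sub, hk_proj 𝕂 ht hp hxθ hr hc]
  refine listElement_rootSum_sub 𝕂 hθ ht hL hI ht' ?_ ?_
  · rw [hr, hp'.stepLabel_eq_inl, add_sub_cancel_right]
    omega
  · rw [hc, hp'.stepLabel_eq_inr]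
    omega

theorem hk_mem_rootCone (x : Cylinder m ℓ) : hk 𝕂 θ x ∈ rootCone 𝕂 (kappa m ℓ) := by
  have hr : ∀ y, cellRoot 𝕂 y ∈ rootCone 𝕂 (kappa m ℓ) :=
    fun y => AddSubmonoid.subset_closure ⟨_, rfl⟩
  have hs : ∀ S : Set (Cylinder m ℓ), ∑ᶠ y ∈ S, cellRoot 𝕂 y ∈ rootCone 𝕂 (kappa m ℓ) :=
    fun S => finsum_mem_induction (· ∈ rootCone 𝕂 (kappa m ℓ)) (zero_mem _)
      (fun _ _ => add_mem) fun y _ => hr y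
  exact add_mem (add_mem (hr x) (hs _)) (hs _)

variable {𝕂} [CharZero 𝕂]

theorem inversionSet_listElement (hθ : IsCylindricDiagram θ) {L : List (Cylinder m ℓ)}
    (hL : IsLinearExtension L) (hI : {x | x ∈ L} ∈ properOrderIdeals θ) :
    inversionSet (listElement 𝕂 L) = hk 𝕂 θ '' {x | x ∈ L} ∧ Set.InjOn (hk 𝕂 θ) {x | x ∈ L} := by
  induction L using List.reverseRecOn with
  | nil => simp [listElement, inversionSet_one (two_le_kappa m ℓ)]
  | append_singleton L x ih =>
    obtain ⟨h1, h2, h3⟩ := hL.concat_ideal hI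
    obtain ⟨h4, h5⟩ := ih h1 h2
    have hx := listElement_cellRoot 𝕂 hθ h1 h2 h3
    have hnot := simpleRoot_notMem_inversionSet (two_le_kappa m ℓ) (listElement 𝕂 L) (content x)
    rw [hx, h4] at hnot
    have e : {y | y ∈ L ++ [x]} = insert x {y | y ∈ L} := by
      ext y
      simp [or_comm]
    rw [e, listElement_concat, inversionSet_mul_s (two_le_kappa m ℓ), hx, h4, Set.image_insert_eq]
    · exact ⟨rfl, (Set.injOn_insert h3.1.2).2 ⟨h5, hnot⟩⟩
    · rw [hx]
      exact hk_mem_rootCone 𝕂 x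

theorem encard_inversionSet_listElement (hθ : IsCylindricDiagram θ) {L : List (Cylinder m ℓ)}
    (hL : IsLinearExtension L) (hI : {x | x ∈ L} ∈ properOrderIdeals θ) :
    (inversionSet (listElement 𝕂 L)).encard = L.length := by
  classical
  obtain ⟨h1, h2⟩ := inversionSet_listElement (𝕂 := 𝕂) hθ hL hI
  rw [h1, h2.encard_image, ← List.coe_toFinset, Set.encard_coe_eq_coe_finsetCard,
    List.toFinset_card_of_nodup hL.nodup]

theorem length_listElement (hθ : IsCylindricDiagram θ) {L : List (Cylinder m ℓ)}
    (hL : IsLinearExtension L) (hI : {x | x ∈ L} ∈ properOrderIdeals θ) :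
    length (listElement 𝕂 L) = L.length := by
  refine le_antisymm ?_ ?_
  · have := length_prod_le (𝕂 := 𝕂) (L.map content)
    rwa [List.map_map, List.length_map] at this
  · have := encard_inversionSet_le_length (𝕂 := 𝕂) (two_le_kappa m ℓ) (listElement 𝕂 L)
    rw [encard_inversionSet_listElement hθ hL hI] at this
    exact_mod_cast this

/-- The right descents of the Weyl group element of an order ideal are the contents of its
maximal cells. -/
theorem exists_maximal_of_descent (hθ : IsCylindricDiagram θ) {L : List (Cylinder m ℓ)}
    (hL : IsLinearExtension L) (hI : {x | x ∈ L} ∈ properOrderIdeals θ)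
    {i : ZMod (kappa m ℓ)} (hi : (listElement 𝕂 L).1 (simpleRoot 𝕂 i) ∉ rootCone 𝕂 (kappa m ℓ)) :
    ∃ x, Maximal (· ∈ L) x ∧ content x = i := by
  obtain ⟨t, ht, hp⟩ := hθ.exists_profile
  obtain ⟨t', ht', hp'⟩ := (hθ.sdiff hI).exists_profile
  obtain ⟨p, rfl⟩ := ZMod.intCast_surjective i
  obtain ⟨r, hr⟩ := hp.exists_stepLabel (stepLabel t' (p + 1))
  obtain ⟨c, hc⟩ := hp.exists_stepLabel (stepLabel t' p)
  rw [simpleRoot_eq_rootSum_sub, listElement_rootSum_sub 𝕂 hθ ht hL hI ht' hr.symm hc.symm,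
    rootSum_sub_mem_rootCone_iff 𝕂 (two_le_kappa m ℓ), not_le] at hi
  have hmem : ∀ a b : ℤ, (proj (a, b) : Cylinder m ℓ) ∈ θ \ {x | x ∈ L} ↔ a ≤ t' (b - a) :=
    ht'.mem_iff
  have s1 := hp'.sub_one p
  have s2 := hp'.succ_le p
  have s3 := hp'.le_succ p
  -- `w α_p` is the difference of `rootSum` between the two steps of the boundary of `θ` that
  -- correspond to the steps `p` and `p + 1` of the smaller diagram. It can be negative only if
  -- these are a row and a column crossing in a cell of `θ` outside the smaller diagram.
  rcases hr' : stepLabel t' (p + 1) with a' | b' <;> rcases hc' : stepLabel t' p with a | b <;>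
    rw [hr'] at hr <;> rw [hc'] at hc <;>
    simp only [hp'.stepLabel_eq_inl, hp'.stepLabel_eq_inr, add_sub_cancel_right] at hr' hc'
  · exfalso
    have h1 := mt (hp.lt_iff_of_inl hr r).2 (by
      have := hp.stepLabel_eq_inl.1 hc
      have h2 := hp.antitone (show r ≤ c - 1 by omega)
      omega)
    omega
  · exfalso
    have h0 := ((ht'.mem_iff (t' p) (t' p + p)).2 (by rw [add_sub_cancel_left])).1
    rw [ht] at h0
    obtain rfl : a' = t' p := by omega
    obtain rfl : b = p + t' p := by omega
    have h1 := mt (hp.lt_iff_of_inl hr p).2 (by omega)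
    have h2 := (hp.le_iff_of_inr hc p).1 (by omega)
    omega
  · have h0 : t' (p + 1) = t' p := by omega
    obtain rfl : a = t' p + 1 := by omega
    obtain rfl : b' = t' p + 1 + p := by omega
    have h1 : t' p + 1 ≤ t p := by
      by_contra hlt
      have h2 := (hp.lt_iff_of_inl hc p).1 (by omega)
      have h3 := mt (hp.le_iff_of_inr hr p).2 (by omega)
      omega
    have hup := (hθ.sdiff hI).1
    refine ⟨proj (t' p + 1, t' p + 1 + p), ⟨?_, ?_⟩, content_diagonal _ _⟩
    · by_contra h
      have h2 := (ht' _ _).1 ⟨(ht _ _).2 h1, h⟩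
      omega
    · intro y hy hle
      obtain ⟨v, q, rfl, h3, h4⟩ := exists_lift_of_le hle
      by_contra hlt
      have h5 : (proj (v, v + q) : Cylinder m ℓ) ∉ θ \ {x | x ∈ L} := fun h => h.2 hy
      rw [ht', not_le] at h5
      rcases lt_trichotomy q p with h | rfl | h
      · have := hp'.antitone (show q ≤ p - 1 by omega)
        omega
      · exact hlt (proj_le_proj (by omega) (by omega))
      · have := hp'.monotone (show p + 1 ≤ q by omega)
        simp only at this
        omega
  · exfalso
    have h1 := hp.stepLabel_eq_inr.1 hr
    have h2 := (hp.le_iff_of_inr hc r).1 (by omega)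
    omega

end Fillings

/-! ### Order ideals, weak order and inversion sets -/

section Ideals

variable {m ℓ : ℕ+} {θ : Set (Cylinder m ℓ)}

/-- On each of the `κ` diagonals, the cells of a proper order ideal lie between the profile of its
complement and that of `θ`. -/
theorem finite_of_mem_properOrderIdeals (hθ : IsCylindricDiagram θ) {η : Set (Cylinder m ℓ)}
    (hη : η ∈ properOrderIdeals θ) : η.Finite := by
  have : NeZero (kappa m ℓ) := ⟨by have := two_le_kappa m ℓ; omega⟩
  obtain ⟨t, ht, -⟩ := hθ.exists_profile
  obtain ⟨t', ht', -⟩ := (hθ.sdiff hη).exists_profile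
  refine (Set.finite_iUnion fun i : ZMod (kappa m ℓ) => (Set.finite_Ioc (t' (i.cast : ℤ))
    (t (i.cast : ℤ))).image fun u => (proj (u, u + (i.cast : ℤ)) : Cylinder m ℓ)).subset ?_
  intro x hx
  obtain ⟨u, hu⟩ := exists_lift_of_content (x := x) (p := ((content x).cast : ℤ)) (by simp)
  refine Set.mem_iUnion.2 ⟨content x, u, ⟨?_, ?_⟩, hu⟩
  · rw [← not_le, ← ht', hu]
    exact fun h => h.2 hx
  · rw [← ht, hu]
    exact hη.1.1 hx

/-- The order ideals of a proper order ideal `ξ` of `θ` are proper order ideals of `θ`. -/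
theorem mem_properOrderIdeals_of_subset {ξ η : Set (Cylinder m ℓ)}
    (hξ : ξ ∈ properOrderIdeals θ) (hη : η ∈ orderIdeals (· ≤ ·) ξ) :
    η ∈ properOrderIdeals θ := by
  obtain ⟨⟨h1, h2⟩, h3⟩ := hξ
  obtain ⟨h4, h5⟩ := hη
  refine ⟨⟨h4.trans h1, fun x hx y hy hyx => h5 x hx y (h2 x (h4 hx) y hy hyx) hyx⟩, ?_⟩
  rintro rfl
  exact h3 (h1.antisymm h4)

theorem mem_orderIdeals_of_subset {ξ η : Set (Cylinder m ℓ)} (hξ : ξ ∈ properOrderIdeals θ)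
    (hη : η ∈ properOrderIdeals θ) (h : η ⊆ ξ) : η ∈ orderIdeals (· ≤ ·) ξ :=
  ⟨h, fun x hx y hy hyx => hη.1.2 x hx y (hξ.1.1 hy) hyx⟩

variable (𝕂 : Type*) [Field 𝕂] {ξ : Set (Cylinder m ℓ)}

theorem StandardTableau.exists_list (T : StandardTableau ξ) : ∃ L : List (Cylinder m ℓ),
    IsLinearExtension L ∧ {x | x ∈ L} = ξ ∧ T.weylElement 𝕂 = listElement 𝕂 L := by
  refine ⟨List.ofFn fun k : Fin ξ.ncard =>
    T.cell ⟨(k : ℕ) + 1, Nat.succ_le_succ (Nat.zero_le _), k.2⟩, ?_, ?_, ?_⟩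
  · rw [IsLinearExtension, List.pairwise_ofFn]
    intro i j hij hle
    have hne : T.toEquiv.symm ⟨(j : ℕ) + 1, Nat.succ_le_succ (Nat.zero_le _), j.2⟩ ≠
        T.toEquiv.symm ⟨(i : ℕ) + 1, Nat.succ_le_succ (Nat.zero_le _), i.2⟩ := fun h => by
      have := congrArg Subtype.val (T.toEquiv.symm.injective h)
      simp only at this
      omega
    have := T.lt_of_lt _ _ (lt_of_le_of_ne hle hne)
    rw [Equiv.apply_symm_apply, Equiv.apply_symm_apply] at this
    have h2 : (j : ℕ) + 1 < (i : ℕ) + 1 := this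
    have h3 : (i : ℕ) < j := hij
    omega
  · ext x
    simp only [Set.mem_ofPred_eq, List.mem_ofFn]
    constructor
    · rintro ⟨k, rfl⟩
      exact (T.toEquiv.symm _).2
    · intro hx
      have h1 := (T.toEquiv ⟨x, hx⟩).2
      refine ⟨⟨(T.toEquiv ⟨x, hx⟩ : ℕ) - 1, by have := h1.1; have := h1.2; omega⟩, ?_⟩
      have h2 : (⟨((T.toEquiv ⟨x, hx⟩ : ℕ) - 1) + 1, Nat.succ_le_succ (Nat.zero_le _),
          by have := h1.1; have := h1.2; omega⟩ : Set.Icc 1 ξ.ncard) = T.toEquiv ⟨x, hx⟩ :=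
        Subtype.ext (Nat.sub_add_cancel h1.1)
      simp only [StandardTableau.cell, h2, Equiv.symm_apply_apply]
  · rw [StandardTableau.weylElement, listElement, List.map_ofFn]
    rfl

theorem nonempty_standardTableau {L : List (Cylinder m ℓ)} (hL : IsLinearExtension L)
    (h : {x | x ∈ L} = ξ) : Nonempty (StandardTableau ξ) := by
  classical
  subst h
  have hcard : Set.ncard {x | x ∈ L} = L.length := by
    rw [← List.coe_toFinset, Set.ncard_coe_finset, List.toFinset_card_of_nodup hL.nodup]
  let e : Fin L.length ≃ {x | x ∈ L} := hL.nodup.getEquiv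
  let e' : Fin L.length ≃ Set.Icc 1 (Set.ncard {x | x ∈ L}) :=
    { toFun := fun k => ⟨(k : ℕ) + 1, by omega, by omega⟩
      invFun := fun k => ⟨(k : ℕ) - 1, by have := k.2.1; have := k.2.2; omega⟩
      left_inv := fun k => by simp
      right_inv := fun k => Subtype.ext (Nat.sub_add_cancel k.2.1) }
  refine ⟨⟨e.symm.trans e', fun x y hxy => ?_⟩⟩
  obtain ⟨i, rfl⟩ := e.surjective x
  obtain ⟨j, rfl⟩ := e.surjective y
  simp only [Equiv.trans_apply, Equiv.symm_apply_apply]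
  have hij : i < j := by
    by_contra hji
    rcases (not_lt.1 hji).lt_or_eq with h | rfl
    · exact List.pairwise_iff_get.1 hL j i h hxy.le
    · exact lt_irrefl _ hxy
  exact Nat.succ_lt_succ hij

/-- `w_ξ` can be computed from any linear extension, whatever tableau was chosen. -/
theorem weylElement_eq_listElement {L : List (Cylinder m ℓ)} (hL : IsLinearExtension L)
    (h : {x | x ∈ L} = ξ) : weylElement 𝕂 ξ = listElement 𝕂 L := by
  have hne := nonempty_standardTableau hL h
  obtain ⟨M, h1, h2, h3⟩ := hne.some.exists_list 𝕂
  rw [weylElement, dif_pos hne, h3]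
  exact listElement_eq 𝕂 h1 hL (h2.trans h.symm)

theorem exists_weylElement_eq (hθ : IsCylindricDiagram θ) (hξ : ξ ∈ properOrderIdeals θ) :
    ∃ L : List (Cylinder m ℓ), IsLinearExtension L ∧ {x | x ∈ L} = ξ ∧
      weylElement 𝕂 ξ = listElement 𝕂 L := by
  obtain ⟨L, h1, h2⟩ := exists_isLinearExtension ξ (finite_of_mem_properOrderIdeals hθ hξ)
  exact ⟨L, h1, h2, weylElement_eq_listElement 𝕂 h1 h2⟩

theorem weylElement_empty : weylElement 𝕂 (∅ : Set (Cylinder m ℓ)) = 1 :=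
  weylElement_eq_listElement 𝕂 (L := []) List.Pairwise.nil (by simp)

variable {𝕂} [CharZero 𝕂]

theorem bijOn_hk (hθ : IsCylindricDiagram θ) (hξ : ξ ∈ properOrderIdeals θ) :
    Set.BijOn (hk 𝕂 θ) ξ (inversionSet (weylElement 𝕂 ξ)) := by
  obtain ⟨L, h1, rfl, h3⟩ := exists_weylElement_eq 𝕂 hθ hξ
  obtain ⟨h4, h5⟩ := inversionSet_listElement (𝕂 := 𝕂) hθ h1 hξ
  rw [h3, h4]
  exact h5.bijOn_image

theorem inversionSet_weylElement (hθ : IsCylindricDiagram θ) (hξ : ξ ∈ properOrderIdeals θ) :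
    inversionSet (weylElement 𝕂 ξ) = hk 𝕂 θ '' ξ :=
  (bijOn_hk hθ hξ).image_eq.symm

theorem isPosetIso_hk (hθ : IsCylindricDiagram θ) (hξ : ξ ∈ properOrderIdeals θ) :
    IsPosetIso (· ≤ ·) ξ (cylLE θ) (inversionSet (weylElement 𝕂 ξ)) (hk 𝕂 θ) := by
  obtain ⟨t, ht, hp⟩ := hθ.exists_profile
  exact ⟨bijOn_hk hθ hξ, fun x hx y hy => le_iff_cylLE_hk ht hp (hξ.1.1 hx) (hξ.1.1 hy)⟩

/-- Elements below `w_ξ` in the weak order come from order ideals of `ξ`: a descent of `w_ξ`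
removes a maximal cell of `ξ`. -/
theorem exists_of_weakLE (hθ : IsCylindricDiagram θ) (hξ : ξ ∈ properOrderIdeals θ)
    {v : weylGroup 𝕂 (kappa m ℓ)} (h : weakLE v (weylElement 𝕂 ξ)) :
    ∃ η ∈ properOrderIdeals θ, η ⊆ ξ ∧ weylElement 𝕂 η = v := by
  have hκ := two_le_kappa m ℓ
  induction h using Relation.ReflTransGen.head_induction_on with
  | refl => exact ⟨ξ, hξ, Set.Subset.rfl, rfl⟩
  | @head v _ hc _ ih =>
    obtain ⟨η, hη, hηξ, rfl⟩ := ih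
    obtain ⟨hlen, i, hi⟩ := hc
    have hv : v = weylElement 𝕂 η * s 𝕂 i := by
      rw [hi, mul_assoc, s_mul_self, mul_one]
    obtain ⟨L, h1, rfl, h3⟩ := exists_weylElement_eq 𝕂 hθ hη
    rw [h3] at hlen hv
    have hdesc : (listElement 𝕂 L).1 (simpleRoot 𝕂 i) ∉ rootCone 𝕂 (kappa m ℓ) := by
      intro hpos
      -- otherwise `v` has one inversion more than `w`, which its length does not allow
      have h4 := encard_inversionSet_le_length hκ v
      have h5 := simpleRoot_notMem_inversionSet hκ (listElement 𝕂 L) i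
      rw [hv, inversionSet_mul_s hκ _ _ hpos, Set.encard_insert_of_notMem h5,
        encard_inversionSet_listElement hθ h1 hη, ← hv] at h4
      rw [length_listElement hθ h1 hη] at hlen
      have h6 : L.length + 1 ≤ length v := by exact_mod_cast h4
      omega
    obtain ⟨x, hx, rfl⟩ := exists_maximal_of_descent hθ h1 hη hdesc
    obtain ⟨M, hM, hM'⟩ := exists_isLinearExtension ({y | y ∈ L} \ {x})
      (L.finite_toSet.subset Set.sdiff_subset)
    have hMx : IsLinearExtension (M ++ [x]) := isLinearExtension_concat.2 ⟨hM, fun y hy hxy => by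
      have hy' : y ∈ {y | y ∈ L} \ {x} := hM' ▸ hy
      exact hy'.2 (le_antisymm (hx.2 hy'.1 hxy) hxy)⟩
    have hset : {y | y ∈ M ++ [x]} = {y | y ∈ L} := by
      have e : {y | y ∈ M ++ [x]} = {y | y ∈ M} ∪ {x} := by
        ext y
        simp [or_comm]
      rw [e, hM', Set.sdiff_union_self, Set.union_eq_self_of_subset_right]
      exact Set.singleton_subset_iff.2 hx.1
    have hI := (hMx.concat_ideal (hset.symm ▸ hη)).2.1
    refine ⟨_, hI, ?_, ?_⟩
    · rw [hM']
      exact Set.sdiff_subset.trans hηξ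
    · rw [weylElement_eq_listElement 𝕂 hM rfl, hv, listElement_eq 𝕂 h1 hMx hset.symm,
        listElement_concat, mul_assoc, s_mul_self, mul_one]

theorem weakLE_of_append (hθ : IsCylindricDiagram θ) {L M : List (Cylinder m ℓ)}
    (hL : IsLinearExtension (L ++ M)) (hI : {x | x ∈ L ++ M} ∈ properOrderIdeals θ) :
    weakLE (listElement 𝕂 L) (listElement 𝕂 (L ++ M)) := by
  induction M using List.reverseRecOn with
  | nil =>
    rw [List.append_nil]
    exact Relation.ReflTransGen.refl
  | append_singleton M x ih =>
    rw [← List.append_assoc] at hL hI ⊢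
    obtain ⟨h1, h2, -⟩ := hL.concat_ideal hI
    refine (ih h1 h2).tail ⟨?_, content x, listElement_concat 𝕂 _ _⟩
    rw [length_listElement hθ hL hI, length_listElement hθ h1 h2, List.length_append,
      List.length_singleton]

theorem weakLE_weylElement_of_subset (hθ : IsCylindricDiagram θ) (hξ : ξ ∈ properOrderIdeals θ)
    {η : Set (Cylinder m ℓ)} (hη : η ∈ properOrderIdeals θ) (h : η ⊆ ξ) :
    weakLE (weylElement 𝕂 η) (weylElement 𝕂 ξ) := by
  obtain ⟨L, h1, h2, h3⟩ := exists_weylElement_eq 𝕂 hθ hη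
  obtain ⟨M, h4, h5⟩ := exists_isLinearExtension (ξ \ η)
    ((finite_of_mem_properOrderIdeals hθ hξ).subset Set.sdiff_subset)
  have hset : {x | x ∈ L ++ M} = ξ := by
    have e : {x | x ∈ L ++ M} = {x | x ∈ L} ∪ {x | x ∈ M} := by
      ext
      simp
    rw [e, h2, h5, Set.union_sdiff_cancel h]
  have hLM : IsLinearExtension (L ++ M) := List.pairwise_append.2 ⟨h1, h4, fun x hx y hy hyx => by
    have hx' : x ∈ η := h2 ▸ hx
    have hy' : y ∈ ξ \ η := h5 ▸ hy
    exact hy'.2 (hη.1.2 x hx' y (hξ.1.1 hy'.1) hyx)⟩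
  rw [h3, weylElement_eq_listElement 𝕂 hLM hset]
  exact weakLE_of_append hθ hLM (hset.symm ▸ hξ)

theorem subset_iff_inversionSet_subset (hθ : IsCylindricDiagram θ) (hξ : ξ ∈ properOrderIdeals θ)
    {η η' : Set (Cylinder m ℓ)} (hη : η ∈ orderIdeals (· ≤ ·) ξ)
    (hη' : η' ∈ orderIdeals (· ≤ ·) ξ) :
    η ⊆ η' ↔ inversionSet (weylElement 𝕂 η) ⊆ inversionSet (weylElement 𝕂 η') := by
  rw [inversionSet_weylElement hθ (mem_properOrderIdeals_of_subset hξ hη),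
    inversionSet_weylElement hθ (mem_properOrderIdeals_of_subset hξ hη'),
    (bijOn_hk hθ hξ).injOn.image_subset_image_iff hη.1 hη'.1]

theorem isPosetIso_weylElement (hθ : IsCylindricDiagram θ) (hξ : ξ ∈ properOrderIdeals θ) :
    IsPosetIso (· ⊆ ·) (orderIdeals (· ≤ ·) ξ) weakLE (weakInterval (weylElement 𝕂 ξ))
      (fun η => weylElement 𝕂 η) := by
  have hsub := fun η hη => mem_properOrderIdeals_of_subset (η := η) hξ hη
  have hinj : ∀ η ∈ orderIdeals (· ≤ ·) ξ, ∀ η' ∈ orderIdeals (· ≤ ·) ξ,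
      weylElement 𝕂 η = weylElement 𝕂 η' → η = η' := by
    intro η hη η' hη' h
    refine Set.Subset.antisymm ?_ ?_
    · rw [subset_iff_inversionSet_subset (𝕂 := 𝕂) hθ hξ hη hη', h]
    · rw [subset_iff_inversionSet_subset (𝕂 := 𝕂) hθ hξ hη' hη, h]
  refine ⟨⟨fun η hη => ⟨?_, ?_⟩, fun η hη η' hη' h => hinj η hη η' hη' h, ?_⟩, ?_⟩
  · rw [← weylElement_empty]
    refine weakLE_weylElement_of_subset hθ (hsub η hη) (hsub ∅ ?_) (Set.empty_subset _)
    exact ⟨Set.empty_subset _, fun x hx => absurd hx (Set.notMem_empty x)⟩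
  · exact weakLE_weylElement_of_subset hθ hξ (hsub η hη) hη.1
  · rintro v ⟨-, hv⟩
    obtain ⟨η, hη, hηξ, rfl⟩ := exists_of_weakLE hθ hξ hv
    exact ⟨η, mem_orderIdeals_of_subset hξ hη hηξ, rfl⟩
  · intro η hη η' hη'
    refine ⟨weakLE_weylElement_of_subset hθ (hsub η' hη') (hsub η hη), fun h => ?_⟩
    obtain ⟨ζ, hζ, hζη, e⟩ := exists_of_weakLE hθ (hsub η' hη') h
    rwa [← hinj ζ (mem_orderIdeals_of_subset hξ hζ (hζη.trans hη'.1)) η hη e]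

theorem IsPosetIso.bijOn_image_orderIdeals {A B : Type*} {rA : A → A → Prop} {S : Set A}
    {rB : B → B → Prop} {T : Set B} {f : A → B} (hf : IsPosetIso rA S rB T f) :
    Set.BijOn (Set.image f) (orderIdeals rA S) (orderIdeals rB T) := by
  obtain ⟨hb, ho⟩ := hf
  refine ⟨?_, ?_, ?_⟩
  · rintro J ⟨h1, h2⟩
    refine ⟨(Set.image_mono h1).trans hb.image_eq.subset, ?_⟩
    rintro _ ⟨x, hx, rfl⟩ y hy hyx
    obtain ⟨z, hz, rfl⟩ := hb.surjOn hy
    exact ⟨z, h2 x hx z hz ((ho z hz x (h1 hx)).2 hyx), rfl⟩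
  · rintro J hJ J' hJ' h
    exact (hb.injOn.image_eq_image_iff hJ.1 hJ'.1).1 h
  · rintro J ⟨h1, h2⟩
    refine ⟨S ∩ f ⁻¹' J, ⟨Set.inter_subset_left, ?_⟩, ?_⟩
    · rintro x ⟨hx, hx'⟩ y hy hyx
      exact ⟨hy, h2 _ hx' _ (hb.mapsTo hy) ((ho y hy x hx).1 hyx)⟩
    · rw [Set.image_inter_preimage, hb.image_eq, Set.inter_eq_right]
      exact h1

theorem isPosetIso_inversionSet (hθ : IsCylindricDiagram θ) (hξ : ξ ∈ properOrderIdeals θ) :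
    IsPosetIso weakLE (weakInterval (weylElement 𝕂 ξ)) (· ⊆ ·)
      (orderIdeals (cylLE θ) (inversionSet (weylElement 𝕂 ξ))) (fun w => inversionSet w) := by
  obtain ⟨hb, ho⟩ := isPosetIso_weylElement (𝕂 := 𝕂) hθ hξ
  have hB := (isPosetIso_hk (𝕂 := 𝕂) hθ hξ).bijOn_image_orderIdeals
  have hinv : ∀ η ∈ orderIdeals (· ≤ ·) ξ, inversionSet (weylElement 𝕂 η) = hk 𝕂 θ '' η :=
    fun η hη => inversionSet_weylElement hθ (mem_properOrderIdeals_of_subset hξ hη)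
  refine ⟨⟨?_, ?_, ?_⟩, ?_⟩
  · intro w hw
    obtain ⟨η, hη, rfl⟩ := hb.surjOn hw
    simp only [hinv η hη]
    exact hB.mapsTo hη
  · intro w hw w' hw' h
    obtain ⟨η, hη, rfl⟩ := hb.surjOn hw
    obtain ⟨η', hη', rfl⟩ := hb.surjOn hw'
    simp only [hinv η hη, hinv η' hη'] at h
    exact congrArg _ (hB.injOn hη hη' h)
  · intro J hJ
    obtain ⟨η, hη, rfl⟩ := hB.surjOn hJ
    exact ⟨weylElement 𝕂 η, hb.mapsTo hη, hinv η hη⟩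
  · intro w hw w' hw'
    obtain ⟨η, hη, rfl⟩ := hb.surjOn hw
    obtain ⟨η', hη', rfl⟩ := hb.surjOn hw'
    exact (ho η hη η' hη').symm.trans (subset_iff_inversionSet_subset hθ hξ hη hη')

end Ideals

/-! ### The heap order -/

section Heaps

variable {m ℓ : ℕ+} {θ ξ : Set (Cylinder m ℓ)} {𝕂 : Type*} [Field 𝕂]

/-- Cells whose reflections do not commute, or whose contents agree, are comparable, and then a
standard tableau lists the smaller one first. -/
theorem StandardTableau.le_of_heapLE (T : StandardTableau ξ) (x y : ξ)
    (h : T.heapLE 𝕂 (T.toEquiv x) (T.toEquiv y)) : x ≤ y := by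
  have hstep : ∀ i j : Set.Icc 1 ξ.ncard, (i ≤ j ∧
      (cellReflection 𝕂 (T.cell i) * cellReflection 𝕂 (T.cell j) ≠
        cellReflection 𝕂 (T.cell j) * cellReflection 𝕂 (T.cell i) ∨
      content (T.cell i) = content (T.cell j))) → T.toEquiv.symm i ≤ T.toEquiv.symm j := by
    rintro i j ⟨hij, h⟩
    by_contra hle
    have hnot : ¬ T.cell j ≤ T.cell i := fun hle' => by
      rcases (show T.toEquiv.symm j ≤ T.toEquiv.symm i from hle').eq_or_lt with e | hlt
      · exact hle e.ge
      · have := T.lt_of_lt _ _ hlt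
        rw [Equiv.apply_symm_apply, Equiv.apply_symm_apply] at this
        exact absurd this (not_lt.2 hij)
    rcases h with h | h
    · exact h (cellReflection_mul_comm 𝕂 hle hnot)
    · have := le_or_le_of_content (x := T.cell i) (y := T.cell j) (Or.inl h.symm)
      exact this.elim hle hnot
  have key : ∀ i j, T.heapLE 𝕂 i j → T.toEquiv.symm i ≤ T.toEquiv.symm j := by
    intro i j h
    induction h with
    | single h => exact hstep _ _ h
    | tail _ h ih => exact ih.trans (hstep _ _ h)
  simpa using key _ _ h

variable [CharZero 𝕂]

theorem cellReflection_mul_ne {x y : Cylinder m ℓ} (h : content y = content x + 1) :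
    cellReflection 𝕂 x * cellReflection 𝕂 y ≠ cellReflection 𝕂 y * cellReflection 𝕂 x := by
  have hκ := two_le_kappa m ℓ
  have h1 := one_ne_zero_of_two_le hκ
  refine s_mul_ne hκ (fun e => h1 (by linear_combination -h - e)) ?_
  have e1 : content x + 1 ≠ content x := fun e => h1 (by linear_combination e)
  rw [cartanEntry_eq hκ, h, if_neg e1]
  split_ifs <;> simp_all

/-- Neighbouring cells of `ξ` are related in the heap, and chains of neighbours connect any two
comparable cells of `ξ`. -/
theorem StandardTableau.heapLE_of_le (hθ : IsUpperSet θ) (hξ : ξ ∈ properOrderIdeals θ)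
    (T : StandardTableau ξ) (x y : ξ) (hxy : x ≤ y) : T.heapLE 𝕂 (T.toEquiv x) (T.toEquiv y) := by
  have hcell : ∀ x, T.cell (T.toEquiv x) = x := fun x => by simp [StandardTableau.cell]
  have hmono : ∀ x y : ξ, x ≤ y → T.toEquiv x ≤ T.toEquiv y := fun x y h => by
    rcases h.eq_or_lt with rfl | h
    · exact le_rfl
    · exact (T.lt_of_lt x y h).le
  have hstep : ∀ x y : ξ, x ≤ y → (content (y : Cylinder m ℓ) = content (x : Cylinder m ℓ) + 1 ∨
      content (x : Cylinder m ℓ) = content (y : Cylinder m ℓ) + 1) →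
      T.heapLE 𝕂 (T.toEquiv x) (T.toEquiv y) := by
    intro x y h hc
    refine Relation.TransGen.single ⟨hmono x y h, Or.inl ?_⟩
    rw [hcell, hcell]
    rcases hc with hc | hc
    · exact cellReflection_mul_ne hc
    · exact (cellReflection_mul_ne hc).symm
  obtain ⟨x, hx⟩ := x
  obtain ⟨y, hy⟩ := y
  obtain ⟨⟨a, b⟩, ⟨a', b'⟩, rfl, rfl, h1, h2⟩ := hxy
  obtain ⟨j, rfl⟩ := Int.le.dest (show a' ≤ a from h1)
  obtain ⟨k, rfl⟩ := Int.le.dest (show b' ≤ b from h2)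
  clear h1 h2
  have hmem : ∀ i n : ℤ, 0 ≤ i → 0 ≤ n → ∀ z : Cylinder m ℓ, z ∈ ξ → z ≤ proj (a' + i, b' + n) →
      (proj (a' + i, b' + n) : Cylinder m ℓ) ∈ ξ := fun i n hi hn z hz hle =>
    hξ.1.2 _ hy _ (hθ hle (hξ.1.1 hz)) (proj_le_proj (by linarith) (by linarith))
  induction j with
  | zero =>
    induction k with
    | zero =>
      simp only [Nat.cast_zero, add_zero]
      exact Relation.TransGen.single ⟨le_rfl, Or.inr rfl⟩
    | succ k ih =>
      have hle : (proj (a' + ((0 : ℕ) : ℤ), b' + ((k + 1 : ℕ) : ℤ)) : Cylinder m ℓ) ≤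
        proj (a' + ((0 : ℕ) : ℤ), b' + (k : ℤ)) := proj_le_proj le_rfl (by push_cast; linarith)
      refine (hstep ⟨_, hx⟩ ⟨_, hmem _ _ (by simp) (by simp) _ hx hle⟩ hle (Or.inr ?_)).trans
        (ih (hmem _ _ (by simp) (by simp) _ hx hle))
      simp only [content_proj]
      push_cast
      ring
  | succ j ih =>
    have hle : (proj (a' + ((j + 1 : ℕ) : ℤ), b' + (k : ℤ)) : Cylinder m ℓ) ≤
      proj (a' + (j : ℤ), b' + (k : ℤ)) := proj_le_proj (by push_cast; linarith) le_rfl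
    refine (hstep ⟨_, hx⟩ ⟨_, hmem _ _ (by simp) (by simp) _ hx hle⟩ hle (Or.inl ?_)).trans
      (ih (hmem _ _ (by simp) (by simp) _ hx hle))
    simp only [content_proj]
    push_cast
    ring

theorem StandardTableau.isPosetIso_heapLE (hθ : IsUpperSet θ) (hξ : ξ ∈ properOrderIdeals θ)
    (T : StandardTableau ξ) :
    IsPosetIso (· ≤ ·) Set.univ (T.heapLE 𝕂) Set.univ T.toEquiv :=
  ⟨Set.bijOn_univ.2 T.toEquiv.bijective, fun x _ y _ =>
    ⟨T.heapLE_of_le hθ hξ x y, T.le_of_heapLE x y⟩⟩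

end Heaps

end CylindricDiagram

end

open CylindricDiagram
theorem mainTheorem10 (𝕂 : Type*) [Field 𝕂] [CharZero 𝕂] (m ℓ : ℕ+)
    (θ : Set (Cylinder m ℓ)) (hθ : IsCylindricDiagram θ)
    (ξ : Set (Cylinder m ℓ)) (hξ : ξ ∈ properOrderIdeals θ) :
    -- the element `w_ξ` is well defined
    (ξ.Finite ∧ Nonempty (StandardTableau ξ) ∧
      ∀ t : StandardTableau ξ, t.weylElement 𝕂 = weylElement 𝕂 ξ) ∧
    -- `hk : (ξ, ≤) → (R(w_ξ), ≤^cyl)`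
    IsPosetIso (· ≤ ·) ξ (cylLE θ) (inversionSet (weylElement 𝕂 ξ)) (hk 𝕂 θ) ∧
    -- `t : (ξ, ≤) → ([1, n], heap order)` for every standard tableau `t`
    (∀ t : StandardTableau ξ,
      IsPosetIso (· ≤ ·) Set.univ (t.heapLE 𝕂) Set.univ t.toEquiv) ∧
    -- `Φ : (ℐ(ξ), ⊆) → ([e, w_ξ], weak right Bruhat order)`
    IsPosetIso (· ⊆ ·) (orderIdeals (· ≤ ·) ξ) weakLE (weakInterval (weylElement 𝕂 ξ))
      (fun η => weylElement 𝕂 η) ∧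
    -- `Ψ : ([e, w_ξ], weak right Bruhat order) → (ℐ(R(w_ξ)), ⊆)`
    IsPosetIso weakLE (weakInterval (weylElement 𝕂 ξ)) (· ⊆ ·)
      (orderIdeals (cylLE θ) (inversionSet (weylElement 𝕂 ξ)))
      (fun w => inversionSet w) := by
  obtain ⟨L, hL, hLξ, -⟩ := exists_weylElement_eq 𝕂 hθ hξ
  refine ⟨⟨finite_of_mem_properOrderIdeals hθ hξ, nonempty_standardTableau hL hLξ, fun t => ?_⟩,
    isPosetIso_hk hθ hξ, fun t => t.isPosetIso_heapLE hθ.1 hξ, isPosetIso_weylElement hθ hξ,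
    isPosetIso_inversionSet hθ hξ⟩
  obtain ⟨M, hM, hMξ, e⟩ := t.exists_list 𝕂
  rw [e, weylElement_eq_listElement 𝕂 hM hMξ]
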